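/- Let $0<q<1$ and $\alpha\in\{0,1,-1\}$. Let $\mathcal X_0$ be the unital complex $*$-algebra with generators $z,z^*$ and relation $z^*z-q^2zz^*=\alpha(1-q^2)$. Let $\mathcal H=\ell^2(\mathbb Z)$ if $\alpha=0$ and $\mathcal H=\ell^2(\mathbb N_0)$ if $\alpha=\pm1$, with standard orthonormal basis $(e_n)$ and $\mathcal D=\mathrm{Lin}\{e_n\}$. Represent $\mathcal X_0$ on $\mathcal D$ by $$\alpha=0:\ ze_n=q^{n+1}e_{n+1},\quad z^*e_n=q^{n}e_{n-1};$$ $$\alpha=1:\ ze_n=(1-q^{2(n+1)})^{1/2}e_{n+1},\quad z^*e_n=(1-q^{2n})^{1/2}e_{n-1};$$ $$\alpha=-1:\ ze_n=(q^{-2n}-1)^{1/2}e_{n-1},\quad z^*e_n=(q^{-2(n+1)}-1)^{1/2}e_{n+1}.$$ Let $\mathcal X=\mathcal L^+(\mathcal D)$ be the $*$-algebra of all linear operators $T$ on $\mathcal D$ with $T\mathcal D\subseteq\mathcal D$ and $T^*\mathcal D\subseteq\mathcal D$. Put $\beta=1$ if $\alpha=1$ and $\beta=-1$ if $\alpha=0,-1$,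 and $y=\beta(\alpha-zz^*)$; $y$ is invertible in $\mathcal X$. Let $\mathcal X_c$ be the algebra of all $x\in\mathcal X$ such that $y^kxy^l$ is bounded for all $k,l\in\mathbb Z$, and put $\sigma(x)=yxy^{-1}$ for $x\in\mathcal X$ and $h(x)=\mathrm{Tr}\,y^{-1}x$ for $x\in\mathcal X_c$ (the closure of $y^{-1}x$ is of trace class). Define, on $\mathcal D\oplus\mathcal D$, $$\mathcal F=(1-q^2)^{-1}\begin{pmatrix}0&z\\ z^*&0\end{pmatrix},\qquad \rho(x)=\begin{pmatrix}x&0\\0&x\end{pmatrix},\qquad \gamma_q=\begin{pmatrix}q^2&0\\0&-1\end{pmatrix}.$$ Let $(\Gamma,\mathrm d)$ be the first order calculus on $\mathcal X$ with $\mathrm dx=[\mathrm i\mathcal F,\rho(x)]$ and $\Gamma=\mathrm{Lin}\{\rho(x_1)\,\mathrm dx_2\}$; it satisfies $\mathrm dz\,z=q^2z\,\mathrm dz$, $\mathrm dz\,z^*=q^{-2}z^*\mathrm dz$, $\mathrm dz^*z=q^2z\,\mathrm dz^*$, $\mathrm dz^*z^*=q^{-2}z^*\mathrm dz^*$, and $\{\mathrm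 dz,\mathrm dz^*\}$ is a left module basis of $\Gamma$. Let $\Gamma^\wedge$ be the associated universal higher order calculus, that is, the tensor algebra of the bimodule $\Gamma$ over $\mathcal X$ modulo the ideal generated by all $\sum_i\mathrm da_i\otimes\mathrm db_i$ with $\sum_ia_i\,\mathrm db_i=0$, and let $\omega=q^{-2}y^{-2}\,\mathrm dz^*\wedge\mathrm dz$. Then every $\eta\in\Gamma^{\wedge2}$ is $\pi(\eta)\omega$ for a unique $\pi(\eta)\in\mathcal X$; $\omega x=x\omega$ for $x\in\mathcal X$; and $h(x_1x_2)=h(\sigma(x_2)x_1)$ and $h(\pi(\mathrm dx_1\wedge\mathrm dx_2))=0$ for $x_1,x_2\in\mathcal X_c$. The trilinear form $\tau_{\omega,h}(x_0,x_1,x_2)=h(\pi(x_0\,\mathrm dx_1\wedge\mathrm dx_2))$ is a $\sigma$-twisted cyclic 2-cocycle on $\mathcal X_c$: the map $\sigma$ restricts to an algebra automorphism of $\mathcal X_c$ and, for all $x_0,\dots,x_3\in\mathcal X_c$, with $\tau=\tau_{\omega,h}$, $$\tau(x_0x_1,x_2,x_3)-\tau(x_0,x_1x_2,x_3)+\tau(x_0,x_1,x_2x_3)-\tau(\sigma(x_3)x_0,x_1,x_2)=0,\qquad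 \tau(\sigma(x_2),x_0,x_1)=\tau(x_0,x_1,x_2).$$ Moreover, for all $x_0,x_1,x_2\in\mathcal X_c$ the closure of the operator below is of trace class and $$\tau_{\omega,h}(x_0,x_1,x_2)=-\,\mathrm{Tr}\,\gamma_q\,\rho(y^{-1})\rho(x_0)[\mathcal F,\rho(x_1)][\mathcal F,\rho(x_2)].$$ -/

import Mathlib

open scoped InnerProductSpace

noncomputable section

/-! ## Twisted cyclic cocycles -/

section Cyclic

variable {A : Type*} [NonUnitalRing A] [Module ℂ A]

/-- The `σ`-twisted coboundary of an `(n+1)`-linear form `φ`: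
`φ(x₀x₁, …) - φ(x₀, x₁x₂, …) + ⋯ + (-1)^{n+1} φ(σ(x_{n+1})x₀, x₁, …, x_n)`. -/
def twistedCoboundary (σ : A → A) {n : ℕ} (φ : MultilinearMap ℂ (fun _ : Fin (n + 1) => A) ℂ)
    (x : Fin (n + 2) → A) : ℂ :=
  (∑ j : Fin (n + 1), (-1 : ℂ) ^ (j : ℕ) * φ (Fin.contractNth j.castSucc (· * ·) x)) +
    (-1 : ℂ) ^ (n + 1) *
      φ (Fin.cons (σ (x (Fin.last (n + 1))) * x 0) (fun i : Fin n => x i.succ.castSucc))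

/-- The `σ`-twisted cyclicity operator: `(-1)^n φ(σ(x_n), x₀, …, x_{n-1})`. -/
def twistedCyclicity (σ : A → A) {n : ℕ} (φ : MultilinearMap ℂ (fun _ : Fin (n + 1) => A) ℂ)
    (x : Fin (n + 1) → A) : ℂ :=
  (-1 : ℂ) ^ n * φ (Fin.cons (σ (x (Fin.last n))) (fun i : Fin n => x i.castSucc))

/-- `φ` is a `σ`-twisted cyclic `n`-cocycle for the algebra automorphism `σ`. -/
structure IsTwistedCyclicCocycle (σ : A →ₙₐ[ℂ] A) {n : ℕ}
    (φ : MultilinearMap ℂ (fun _ : Fin (n + 1) => A) ℂ) : Prop where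
  bijective : Function.Bijective σ
  coboundary_eq_zero : ∀ x, twistedCoboundary σ φ x = 0
  cyclic : ∀ x, twistedCyclicity σ φ x = φ x

end Cyclic

/-! ## Differential calculi given by a commutator representation

`ρ : A → B` is an algebra homomorphism and `F ∈ B`; the differential is `da = [iF, ρ(a)]`. -/

section Calculus

variable {A B : Type} [Ring A] [Algebra ℂ A] [Ring B] [Algebra ℂ B] (ρ : A →ₐ[ℂ] B) (F : B)

/-- The differential `da = [iF, ρ(a)]`. -/
def dif (a : A) : B := (Complex.I • F) * ρ a - ρ a * (Complex.I • F)

/-- The first order calculus: the span of all `a db = ρ(a)[iF, ρ(b)]`. -/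
def OneForm : Submodule ℂ B := Submodule.span ℂ {g | ∃ a b, g = ρ a * dif ρ F b}

variable {ρ F} in
theorem OneForm.left_mem (a : A) (g : OneForm ρ F) : ρ a * (g : B) ∈ OneForm ρ F := by
  obtain ⟨g, hg⟩ := g
  induction hg using Submodule.span_induction with
  | mem x h =>
    obtain ⟨b, c, rfl⟩ := h
    exact Submodule.subset_span ⟨a * b, c, by simp [mul_assoc]⟩
  | zero => simp
  | add x y _ _ hx hy => simpa [mul_add] using add_mem hx hy
  | smul r x _ hx => simpa using Submodule.smul_mem _ r hx

variable {ρ F} in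
theorem OneForm.right_mem (g : OneForm ρ F) (a : A) : (g : B) * ρ a ∈ OneForm ρ F := by
  obtain ⟨g, hg⟩ := g
  induction hg using Submodule.span_induction with
  | mem x h =>
    obtain ⟨b, c, rfl⟩ := h
    have : ρ b * dif ρ F c * ρ a = ρ b * dif ρ F (c * a) - ρ (b * c) * dif ρ F a := by
      simp only [dif, map_mul]; noncomm_ring
    rw [this]
    exact sub_mem (Submodule.subset_span ⟨_, _, rfl⟩) (Submodule.subset_span ⟨_, _, rfl⟩)
  | zero => simp
  | add x y _ _ hx hy => simpa [add_mul] using add_mem hx hy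
  | smul r x _ hx => simpa using Submodule.smul_mem _ r hx

/-- The left action of `A` on one-forms. -/
def OneForm.lmul (a : A) (g : OneForm ρ F) : OneForm ρ F := ⟨ρ a * g, OneForm.left_mem a g⟩

/-- The right action of `A` on one-forms. -/
def OneForm.rmul (g : OneForm ρ F) (a : A) : OneForm ρ F := ⟨g * ρ a, OneForm.right_mem g a⟩

/-- The differential as a one-form. -/
def OneForm.d (a : A) : OneForm ρ F :=
  ⟨dif ρ F a, Submodule.subset_span ⟨1, a, by simp⟩⟩

/-- The relations of the universal higher order calculus `T_A(Γ)/J` of a first order calculus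
`Γ`: those of the tensor algebra of the `A`-bimodule `Γ` over `A`, on generators `a ∈ A` and
`g ∈ Γ`, and `∑ daᵢ ∧ dbᵢ = 0` whenever `∑ aᵢ dbᵢ = 0` in `Γ`. -/
inductive FormRel : FreeAlgebra ℂ (A ⊕ OneForm ρ F) → FreeAlgebra ℂ (A ⊕ OneForm ρ F) → Prop
  | fn_add (a b : A) : FormRel (FreeAlgebra.ι ℂ (Sum.inl (a + b)))
      (FreeAlgebra.ι ℂ (Sum.inl a) + FreeAlgebra.ι ℂ (Sum.inl b))
  | fn_smul (c : ℂ) (a : A) : FormRel (FreeAlgebra.ι ℂ (Sum.inl (c • a)))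
      (c • FreeAlgebra.ι ℂ (Sum.inl a))
  | fn_one : FormRel (FreeAlgebra.ι ℂ (Sum.inl 1)) 1
  | fn_mul (a b : A) : FormRel (FreeAlgebra.ι ℂ (Sum.inl (a * b)))
      (FreeAlgebra.ι ℂ (Sum.inl a) * FreeAlgebra.ι ℂ (Sum.inl b))
  | form_add (g g' : OneForm ρ F) : FormRel (FreeAlgebra.ι ℂ (Sum.inr (g + g')))
      (FreeAlgebra.ι ℂ (Sum.inr g) + FreeAlgebra.ι ℂ (Sum.inr g'))
  | form_smul (c : ℂ) (g : OneForm ρ F) : FormRel (FreeAlgebra.ι ℂ (Sum.inr (c • g)))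
      (c • FreeAlgebra.ι ℂ (Sum.inr g))
  | left (a : A) (g : OneForm ρ F) : FormRel (FreeAlgebra.ι ℂ (Sum.inr (OneForm.lmul ρ F a g)))
      (FreeAlgebra.ι ℂ (Sum.inl a) * FreeAlgebra.ι ℂ (Sum.inr g))
  | right (g : OneForm ρ F) (a : A) : FormRel (FreeAlgebra.ι ℂ (Sum.inr (OneForm.rmul ρ F g a)))
      (FreeAlgebra.ι ℂ (Sum.inr g) * FreeAlgebra.ι ℂ (Sum.inl a))
  | wedge {n : ℕ} (a b : Fin n → A) (h : ∑ i, ρ (a i) * dif ρ F (b i) = 0) :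
      FormRel (∑ i, FreeAlgebra.ι ℂ (Sum.inr (OneForm.d ρ F (a i))) *
        FreeAlgebra.ι ℂ (Sum.inr (OneForm.d ρ F (b i)))) 0

/-- The algebra `Γ^∧` of differential forms of all orders; its product is the wedge product. -/
abbrev Forms : Type := RingQuot (FormRel ρ F)

/-- `A = Γ^{∧0}` inside `Γ^∧`. -/
def Forms.fn (a : A) : Forms ρ F :=
  RingQuot.mkAlgHom ℂ (FormRel ρ F) (FreeAlgebra.ι ℂ (Sum.inl a))

/-- `Γ = Γ^{∧1}` inside `Γ^∧`. -/
def Forms.one (g : OneForm ρ F) : Forms ρ F :=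
  RingQuot.mkAlgHom ℂ (FormRel ρ F) (FreeAlgebra.ι ℂ (Sum.inr g))

/-- `da` as an element of `Γ^∧`. -/
def Forms.d (a : A) : Forms ρ F := Forms.one ρ F (OneForm.d ρ F a)

/-- The space `Γ^{∧2}` of two-forms: the span of all products of two one-forms. -/
def TwoForm : Submodule ℂ (Forms ρ F) :=
  Submodule.span ℂ {η | ∃ g g', η = Forms.one ρ F g * Forms.one ρ F g'}

/-- The coefficient `π(η)` with `η = π(η) ω`; meaningful when it exists and is unique. -/
def formCoeff (ω η : Forms ρ F) : A := Classical.epsilon fun a => η = Forms.fn ρ F a * ω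

/-- The form `τ_{ω,h}(x₀, x₁, x₂) = h(π(x₀ dx₁ ∧ dx₂))` of a two-form `ω` and a functional `h`. -/
def tauForm (ω : Forms ρ F) (h : A → ℂ) (x₀ x₁ x₂ : A) : ℂ :=
  h (formCoeff ρ F ω (Forms.fn ρ F x₀ * Forms.d ρ F x₁ * Forms.d ρ F x₂))

end Calculus

/-! ## The `∗`-algebra `L⁺(D)` -/

section LPlus

variable (E : Type) [NormedAddCommGroup E] [InnerProductSpace ℂ E]

/-- `L⁺(D)`: the operators on `D` whose adjoint is defined on `D` and maps `D` into `D`. -/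
def LPlus : Subalgebra ℂ (Module.End ℂ E) where
  carrier := {T | ∃ S : Module.End ℂ E, ∀ u v : E, ⟪T u, v⟫_ℂ = ⟪u, S v⟫_ℂ}
  mul_mem' := by
    rintro T T' ⟨S, hS⟩ ⟨S', hS'⟩
    exact ⟨S' * S, fun u v => by simp [hS, hS']⟩
  add_mem' := by
    rintro T T' ⟨S, hS⟩ ⟨S', hS'⟩
    exact ⟨S + S', fun u v => by simp [hS, hS']⟩
  algebraMap_mem' := fun c => ⟨algebraMap ℂ _ (starRingEnd ℂ c), fun u v => by
    simp [Module.algebraMap_end_apply, mul_comm]⟩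

variable {E}

theorem LPlus.adjoint_unique {T T' : Module.End ℂ E}
    (h : ∀ u v : E, ⟪u, T v⟫_ℂ = ⟪u, T' v⟫_ℂ) : T = T' :=
  LinearMap.ext fun v => ext_inner_left ℂ fun u => h u v

theorem LPlus.adjoint_symm {T S : Module.End ℂ E} (h : ∀ u v : E, ⟪T u, v⟫_ℂ = ⟪u, S v⟫_ℂ)
    (u v : E) : ⟪S u, v⟫_ℂ = ⟪u, T v⟫_ℂ := by
  rw [← inner_conj_symm, ← h, inner_conj_symm]

/-- The involution of `L⁺(D)`: the restriction of the adjoint operator to `D`. -/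
instance : Star (LPlus E) where
  star T := ⟨T.2.choose, T.1, LPlus.adjoint_symm T.2.choose_spec⟩

theorem LPlus.inner_star (T : LPlus E) (u v : E) : ⟪T.1 u, v⟫_ℂ = ⟪u, (star T).1 v⟫_ℂ :=
  T.2.choose_spec u v

theorem LPlus.star_eq (T S : LPlus E) (h : ∀ u v : E, ⟪T.1 u, v⟫_ℂ = ⟪u, S.1 v⟫_ℂ) :
    star T = S :=
  Subtype.ext (LPlus.adjoint_unique fun u v => by rw [← h, LPlus.inner_star])

instance : StarRing (LPlus E) where
  star_involutive T := LPlus.star_eq _ _ (LPlus.adjoint_symm (LPlus.inner_star T))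
  star_mul S T := LPlus.star_eq _ _ fun u v => by
    simp [LPlus.inner_star]
  star_add S T := LPlus.star_eq _ _ fun u v => by
    simp [LPlus.inner_star]

/-- Boundedness of a densely defined operator. -/
def IsBddOp (T : LPlus E) : Prop := ∃ C : ℝ, ∀ v : E, ‖T.1 v‖ ≤ C * ‖v‖

theorem IsBddOp.mul {S T : LPlus E} (hS : IsBddOp S) (hT : IsBddOp T) : IsBddOp (S * T) := by
  obtain ⟨C, hC⟩ := hS
  obtain ⟨C', hC'⟩ := hT
  refine ⟨|C| * C', fun v => ?_⟩
  calc ‖S.1 (T.1 v)‖ ≤ C * ‖T.1 v‖ := hC _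
    _ ≤ |C| * ‖T.1 v‖ := by gcongr; exact le_abs_self C
    _ ≤ |C| * (C' * ‖v‖) := by gcongr; exact hC' v
    _ = _ := by ring

theorem IsBddOp.add {S T : LPlus E} (hS : IsBddOp S) (hT : IsBddOp T) : IsBddOp (S + T) := by
  obtain ⟨C, hC⟩ := hS
  obtain ⟨C', hC'⟩ := hT
  refine ⟨C + C', fun v => ?_⟩
  calc ‖S.1 v + T.1 v‖ ≤ ‖S.1 v‖ + ‖T.1 v‖ := norm_add_le _ _
    _ ≤ C * ‖v‖ + C' * ‖v‖ := add_le_add (hC v) (hC' v)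
    _ = _ := by ring

theorem IsBddOp.smul {T : LPlus E} (c : ℂ) (hT : IsBddOp T) : IsBddOp (c • T) := by
  obtain ⟨C, hC⟩ := hT
  refine ⟨‖c‖ * C, fun v => ?_⟩
  calc ‖c • T.1 v‖ = ‖c‖ * ‖T.1 v‖ := norm_smul _ _
    _ ≤ ‖c‖ * (C * ‖v‖) := by gcongr; exact hC v
    _ = _ := by ring

theorem IsBddOp.star {T : LPlus E} (hT : IsBddOp T) : IsBddOp (star T) := by
  obtain ⟨C, hC⟩ := hT
  refine ⟨|C|, fun v => ?_⟩
  by_cases h0 : ‖(Star.star T).1 v‖ = 0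
  · rw [h0]; positivity
  have h1 : ‖(Star.star T).1 v‖ * ‖(Star.star T).1 v‖ ≤ |C| * ‖v‖ * ‖(Star.star T).1 v‖ := by
    have h2 : ⟪(Star.star T).1 v, (Star.star T).1 v⟫_ℂ = ⟪T.1 ((Star.star T).1 v), v⟫_ℂ :=
      (LPlus.inner_star T _ _).symm
    have h3 : ‖⟪(Star.star T).1 v, (Star.star T).1 v⟫_ℂ‖ =
        ‖(Star.star T).1 v‖ * ‖(Star.star T).1 v‖ := by
      rw [inner_self_eq_norm_sq_to_K]; simp [sq]
    rw [← h3, h2]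
    calc _ ≤ ‖T.1 ((Star.star T).1 v)‖ * ‖v‖ := norm_inner_le_norm _ _
      _ ≤ (|C| * ‖(Star.star T).1 v‖) * ‖v‖ := by
        gcongr
        exact (hC _).trans (by gcongr; exact le_abs_self C)
      _ = _ := by ring
  exact le_of_mul_le_mul_right h1 (lt_of_le_of_ne (norm_nonneg _) (Ne.symm h0))

/-- Integer powers `y^k` of an invertible element. -/
def zpowInv {R : Type*} [Ring R] (y : R) : ℤ → R
  | Int.ofNat n => y ^ n
  | Int.negSucc n => Ring.inverse y ^ (n + 1)

theorem zpowInv_star {R : Type*} [Ring R] [StarRing R] {y : R} (hy : star y = y) (k : ℤ) :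
    star (zpowInv y k) = zpowInv y k := by
  cases k with
  | ofNat n => simp [zpowInv, hy]
  | negSucc n => simp [zpowInv, ← Ring.inverse_star, hy]

/-- The set of all `x ∈ L⁺(D)` such that `y^k x y^l` is bounded for all integers `k, l`; it is
a (non-unital) subalgebra, closed under `∗` for symmetric `y`. -/
def bddCore (y : LPlus E) : NonUnitalSubalgebra ℂ (LPlus E) where
  carrier := {x | ∀ k l : ℤ, IsBddOp (zpowInv y k * x * zpowInv y l)}
  zero_mem' := fun k l => ⟨0, fun v => by simp⟩
  add_mem' := fun {a b} ha hb k l => by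
    rw [mul_add, add_mul]; exact (ha k l).add (hb k l)
  mul_mem' := fun {a b} ha hb k l => by
    have h : zpowInv y k * (a * b) * zpowInv y l =
        (zpowInv y k * a * zpowInv y 0) * (zpowInv y 0 * b * zpowInv y l) := by
      have h0 : zpowInv y 0 = 1 := pow_zero y
      rw [h0]; noncomm_ring
    rw [h]; exact (ha k 0).mul (hb 0 l)
  smul_mem' := fun c x hx k l => by
    rw [mul_smul_comm, smul_mul_assoc]; exact (hx k l).smul c

theorem bddCore_star_mem (y : LPlus E) (hy : star y = y) {x : LPlus E} (hx : x ∈ bddCore y) :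
    star x ∈ bddCore y := fun k l => by
  have h := (hx l k).star
  rwa [star_mul, star_mul, zpowInv_star hy, zpowInv_star hy, ← mul_assoc] at h

end LPlus

/-! ## Trace class operators -/

section Trace

variable {K : Type} [NormedAddCommGroup K] [InnerProductSpace ℂ K]

/-- Trace class operators: `A = ∑ₙ ⟨uₙ, ·⟩ vₙ` with `∑ₙ ‖uₙ‖ ‖vₙ‖ < ∞`. -/
def IsTraceClass (A : K →L[ℂ] K) : Prop :=
  ∃ u v : ℕ → K, Summable (fun n => ‖u n‖ * ‖v n‖) ∧ ∀ x, HasSum (fun n => ⟪u n, x⟫_ℂ • v n) (A x)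

/-- The closure of the operator `T` with dense domain `E` is an everywhere defined trace class
operator (such a closure is the unique continuous extension of `T`). -/
def HasTraceClassClosure {E : Submodule ℂ K} (T : Module.End ℂ E) : Prop :=
  ∃ A : K →L[ℂ] K, (∀ v : E, A v = T v) ∧ IsTraceClass A

/-- The trace `∑ₖ ⟨bₖ, T bₖ⟩` of (the closure of) `T`, for an orthonormal basis `b` of the Hilbert
space which lies in the domain of `T`. -/
def opTrace {E : Submodule ℂ K} {κ : Type} (b : κ → E) (T : Module.End ℂ E) : ℂ :=
  ∑' k, ⟪b k, T (b k)⟫_ℂ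

end Trace

/-! ## The Hilbert spaces and their dense domains -/

section Hilbert

/-- The standard orthonormal basis `eₙ` of `l²(ι)`. -/
def stdBasis (ι : Type) : HilbertBasis ι ℂ (lp (fun _ : ι => ℂ) 2) :=
  HilbertBasis.ofRepr (LinearIsometryEquiv.refl ℂ _)

variable {ι K : Type} [NormedAddCommGroup K] [InnerProductSpace ℂ K] (e : HilbertBasis ι ℂ K)

/-- The linear span `D` of the vectors `eₙ`. -/
def Dom : Submodule ℂ (K) := Submodule.span ℂ (Set.range e)

/-- The `eₙ` as an algebraic basis of `D`. -/
def domBasis : Module.Basis ι ℂ (Dom e) :=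
  Module.Basis.span e.orthonormal.linearIndependent

theorem domBasis_coe (n : ι) : (domBasis e n : K) = e n :=
  congrArg Subtype.val (Module.Basis.span_apply e.orthonormal.linearIndependent n)

theorem domBasis_inner [DecidableEq ι] (m n : ι) :
    ⟪domBasis e m, domBasis e n⟫_ℂ = if m = n then 1 else 0 := by
  rw [Submodule.coe_inner, domBasis_coe, domBasis_coe]
  exact orthonormal_iff_ite.1 e.orthonormal m n

/-- The operator `eₙ ↦ w(n) e_{s(n)}` on `D`. -/
def weightedShift (w : ι → ℝ) (s : ι → ι) : Module.End ℂ (Dom e) :=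
  (domBasis e).constr ℂ fun n => (w n : ℂ) • domBasis e (s n)

theorem weightedShift_apply (w : ι → ℝ) (s : ι → ι) (n : ι) :
    weightedShift e w s (domBasis e n) = (w n : ℂ) • domBasis e (s n) := by
  simp [weightedShift]

theorem weightedShift_adjoint (w w' : ι → ℝ) (s s' : ι → ι)
    (h1 : ∀ n, w n ≠ 0 → s' (s n) = n ∧ w' (s n) = w n)
    (h2 : ∀ n, w' n ≠ 0 → s (s' n) = n ∧ w (s' n) = w' n) (u v : Dom e) :
    ⟪weightedShift e w s u, v⟫_ℂ = ⟪u, weightedShift e w' s' v⟫_ℂ := by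
  classical
  have key : ∀ m n, ⟪weightedShift e w s (domBasis e m), domBasis e n⟫_ℂ =
      ⟪domBasis e m, weightedShift e w' s' (domBasis e n)⟫_ℂ := by
    intro m n
    rw [weightedShift_apply, weightedShift_apply, inner_smul_left, inner_smul_right,
      domBasis_inner, domBasis_inner, Complex.conj_ofReal]
    by_cases hm : s m = n
    · by_cases hw : w m = 0
      · by_cases hn : m = s' n
        · by_cases hw' : w' n = 0
          · simp [hw, hw']
          · exact absurd ((h2 n hw').2.symm.trans (hn ▸ hw)) hw'
        · simp [hw, hn]
      · obtain ⟨h3, h4⟩ := h1 m hw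
        subst hm
        simp [h3, h4]
    · by_cases hn : m = s' n
      · by_cases hw' : w' n = 0
        · simp [hm, hw']
        · exact absurd (hn ▸ (h2 n hw').1) hm
      · simp [hm, hn]
  have h3 : ∀ m v, ⟪weightedShift e w s (domBasis e m), v⟫_ℂ =
      ⟪domBasis e m, weightedShift e w' s' v⟫_ℂ := by
    intro m v
    have hv := (domBasis e).mem_span v
    induction hv using Submodule.span_induction with
    | mem x hx => obtain ⟨i, rfl⟩ := hx; exact key m i
    | zero => simp
    | add x y _ _ hx hy => rw [inner_add_right, hx, hy, map_add, inner_add_right]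
    | smul c x _ hx => rw [inner_smul_right, hx, map_smul, inner_smul_right]
  have hu := (domBasis e).mem_span u
  induction hu using Submodule.span_induction with
  | mem x hx => obtain ⟨i, rfl⟩ := hx; exact h3 i v
  | zero => simp
  | add x y _ _ hx hy => rw [map_add, inner_add_left, hx, hy, inner_add_left]
  | smul c x _ hx => rw [map_smul, inner_smul_left, hx, inner_smul_left]

/-- The dense domain `D ⊕ D` of the Hilbert space `K ⊕ K`. -/
def Dom₂ : Submodule ℂ (PiLp 2 fun _ : Fin 2 => K) where
  carrier := {w | ∀ i, w i ∈ Dom e}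
  zero_mem' := fun _ => zero_mem _
  add_mem' := fun ha hb i => add_mem (ha i) (hb i)
  smul_mem' := fun c _ hx i => Submodule.smul_mem _ c (hx i)

/-- The orthonormal basis `(eₙ, 0), (0, eₙ)` of `K ⊕ K`. -/
def dom₂Basis (k : Fin 2 × ι) : Dom₂ e :=
  ⟨WithLp.toLp 2 (Pi.single k.1 (domBasis e k.2 : K)), fun i => by
    by_cases h : i = k.1
    · subst h; simp
    · simp [h]⟩

variable {e}

/-- The operator on `D ⊕ D` given by a `2 × 2` matrix of operators on `D`. -/
def matrixOp (M : Matrix (Fin 2) (Fin 2) (LPlus (Dom e))) : Module.End ℂ (Dom₂ e) where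
  toFun w := ⟨WithLp.toLp 2 fun i => ((∑ j, (M i j).1 ⟨w.1 j, w.2 j⟩ : Dom e) : K),
    fun i => (∑ j, (M i j).1 ⟨w.1 j, w.2 j⟩ : Dom e).2⟩
  map_add' w w' := by
    ext1
    refine PiLp.ext fun i => ?_
    have h : ∀ j, (⟨(w + w').1 j, (w + w').2 j⟩ : Dom e) = ⟨w.1 j, w.2 j⟩ + ⟨w'.1 j, w'.2 j⟩ :=
      fun j => rfl
    simp only [h, map_add, Finset.sum_add_distrib]
    rfl
  map_smul' c w := by
    ext1
    refine PiLp.ext fun i => ?_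
    have h : ∀ j, (⟨(c • w).1 j, (c • w).2 j⟩ : Dom e) = c • ⟨w.1 j, w.2 j⟩ := fun j => rfl
    simp only [h, map_smul, ← Finset.smul_sum]
    rfl

end Hilbert

/-! ## The quantum plane, the quantum disc and the stereographic projection

The parameter `α ∈ {0, 1, -1}` is an element of `SignType`. -/

section Quantum

/-- The defining relation `z∗z - q²zz∗ = α(1 - q²)`; generator `0` is `z` and `1` is `z∗`. -/
inductive X₀Rel (q : ℝ) (α : SignType) :
    FreeAlgebra ℂ (Fin 2) → FreeAlgebra ℂ (Fin 2) → Prop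
  | rel : X₀Rel q α
      (FreeAlgebra.ι ℂ 1 * FreeAlgebra.ι ℂ 0 -
        (q : ℂ) ^ 2 • (FreeAlgebra.ι ℂ 0 * FreeAlgebra.ι ℂ 1))
      (algebraMap ℂ _ (SignType.cast α * (1 - (q : ℂ) ^ 2)))

/-- The unital complex algebra with generators `z, z∗` and the defining relation. Its involution
exchanges the generators, so a `∗`-homomorphism is an algebra homomorphism `φ` with
`φ(z∗) = φ(z)∗`. -/
abbrev X₀ (q : ℝ) (α : SignType) : Type := RingQuot (X₀Rel q α)

/-- The generators `z` and `z∗` of `X₀`. -/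
def X₀.gen (q : ℝ) (α : SignType) (i : Fin 2) : X₀ q α :=
  RingQuot.mkAlgHom ℂ (X₀Rel q α) (FreeAlgebra.ι ℂ i)

/-- The index set of the orthonormal basis: `ℤ` for `α = 0` and `ℕ` for `α = ±1`. -/
@[reducible] def Idx : SignType → Type
  | .zero => ℤ
  | .neg => ℕ
  | .pos => ℕ

/-- The orthonormal basis `eₙ` of `l²(ℤ)` or `l²(ℕ)`. -/
@[reducible] def eBasis (α : SignType) : HilbertBasis (Idx α) ℂ (lp (fun _ : Idx α => ℂ) 2) :=
  stdBasis (Idx α)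

/-- The operator `z` on `D`. -/
def zOp (q : ℝ) : (α : SignType) → Module.End ℂ (Dom (eBasis α))
  | .zero => weightedShift (stdBasis ℤ) (fun n => q ^ (n + 1)) (fun n => n + 1)
  | .neg => weightedShift (stdBasis ℕ) (fun n => √((q ^ (2 * n))⁻¹ - 1)) (fun n => n - 1)
  | .pos => weightedShift (stdBasis ℕ) (fun n => √(1 - q ^ (2 * (n + 1)))) (fun n => n + 1)

/-- The operator `z∗` on `D`. -/
def zsOp (q : ℝ) : (α : SignType) → Module.End ℂ (Dom (eBasis α))
  | .zero => weightedShift (stdBasis ℤ) (fun n => q ^ n) (fun n => n - 1)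
  | .neg => weightedShift (stdBasis ℕ) (fun n => √((q ^ (2 * (n + 1)))⁻¹ - 1)) (fun n => n + 1)
  | .pos => weightedShift (stdBasis ℕ) (fun n => √(1 - q ^ (2 * n))) (fun n => n - 1)

theorem zOp_adjoint (q : ℝ) (α : SignType) (u v : Dom (eBasis α)) :
    ⟪zOp q α u, v⟫_ℂ = ⟪u, zsOp q α v⟫_ℂ := by
  cases α with
  | zero => exact weightedShift_adjoint _ _ _ _ _ (fun n _ => by simp) (fun n _ => by simp) u v
  | neg =>
    refine weightedShift_adjoint _ _ _ _ _ (fun n hn => ?_) (fun n _ => by simp) u v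
    cases n with
    | zero => simp at hn
    | succ n => simp
  | pos =>
    refine weightedShift_adjoint _ _ _ _ _ (fun n _ => by simp) (fun n hn => ?_) u v
    cases n with
    | zero => simp at hn
    | succ n => simp

/-- The `∗`-algebra `X = L⁺(D)`. -/
abbrev XAlg (α : SignType) : Type := LPlus (Dom (eBasis α))

/-- The element `z` of `X`. -/
def zX (q : ℝ) (α : SignType) : XAlg α := ⟨zOp q α, zsOp q α, zOp_adjoint q α⟩

theorem zX_star (q : ℝ) (α : SignType) : (star (zX q α)).1 = zsOp q α :=
  congrArg Subtype.val (LPlus.star_eq (zX q α)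
    ⟨zsOp q α, zOp q α, LPlus.adjoint_symm (zOp_adjoint q α)⟩ (zOp_adjoint q α))

/-- The sign `β`: `1` for `α = 1`, and `-1` for `α = 0, -1`. -/
def betaSign : SignType → ℝ
  | .zero => -1
  | .neg => -1
  | .pos => 1

/-- The operator `y = β(α - zz∗)`. -/
def yX (q : ℝ) (α : SignType) : XAlg α :=
  (betaSign α : ℂ) • (algebraMap ℂ (XAlg α) (SignType.cast α) - zX q α * star (zX q α))

theorem algebraMap_star (α : SignType) (c : ℝ) :
    star (algebraMap ℂ (XAlg α) (c : ℂ)) = algebraMap ℂ (XAlg α) (c : ℂ) :=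
  LPlus.star_eq _ _ fun u v => by
    change ⟪(c : ℂ) • u, v⟫_ℂ = ⟪u, (c : ℂ) • v⟫_ℂ
    simp

theorem yX_star (q : ℝ) (α : SignType) : star (yX q α) = yX q α := by
  have h : (SignType.cast α : ℂ) = ((SignType.cast α : ℝ) : ℂ) := by cases α <;> simp [SignType.cast]
  rw [yX, Algebra.smul_def]
  simp only [star_mul, star_sub, star_star, h, algebraMap_star]
  exact (Algebra.commutes _ _).symm

/-- `y⁻¹`. -/
def yInv (q : ℝ) (α : SignType) : XAlg α := Ring.inverse (yX q α)

/-- `X_c`: all `x ∈ X` such that `y^k x y^l` is bounded for all integers `k, l`. -/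
def Xc (q : ℝ) (α : SignType) : NonUnitalSubalgebra ℂ (XAlg α) := bddCore (yX q α)

instance (q : ℝ) (α : SignType) : NonUnitalRing (Xc q α) :=
  NonUnitalSubalgebra.toNonUnitalRing (Xc q α)

/-- `σ(x) = y x y⁻¹`. -/
def sigmaX (q : ℝ) (α : SignType) (x : XAlg α) : XAlg α := yX q α * x * yInv q α

/-- The functional `h(x) = Tr y⁻¹x`. -/
def hX (q : ℝ) (α : SignType) (x : XAlg α) : ℂ :=
  opTrace (domBasis (eBasis α)) (yInv q α * x).1

/-- The algebra of `2 × 2` matrices over `X`, acting on `D ⊕ D`. -/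
abbrev MX (α : SignType) : Type := Matrix (Fin 2) (Fin 2) (XAlg α)

/-- `ρ(x) = diag(x, x)`. -/
def rhoX (α : SignType) : XAlg α →ₐ[ℂ] MX α := Matrix.scalarAlgHom (Fin 2) ℂ

/-- `F = (1 - q²)⁻¹` times the matrix with off-diagonal entries `z` and `z∗`. -/
def FX (q : ℝ) (α : SignType) : MX α :=
  ((1 - (q : ℂ) ^ 2)⁻¹) • !![0, zX q α; star (zX q α), 0]

/-- The grading operator `diag(q², -1)`. -/
def gammaX (q : ℝ) (α : SignType) : MX α := !![algebraMap ℂ _ ((q : ℂ) ^ 2), 0; 0, -1]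

/-- The two-form `ω = q⁻² y⁻² dz∗ ∧ dz`. -/
def omegaX (q : ℝ) (α : SignType) : Forms (rhoX α) (FX q α) :=
  ((q : ℂ) ^ 2)⁻¹ • (Forms.fn (rhoX α) (FX q α) (yInv q α ^ 2) *
    Forms.d (rhoX α) (FX q α) (star (zX q α)) * Forms.d (rhoX α) (FX q α) (zX q α))

/-- The operator `γ_q ρ(y⁻¹) ρ(x₀) [F, ρ(x₁)] [F, ρ(x₂)]`. -/
def commOp (q : ℝ) (α : SignType) (x₀ x₁ x₂ : XAlg α) : MX α :=
  gammaX q α * rhoX α (yInv q α) * rhoX α x₀ *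
    (FX q α * rhoX α x₁ - rhoX α x₁ * FX q α) * (FX q α * rhoX α x₂ - rhoX α x₂ * FX q α)

end Quantum

end

noncomputable section

/-! ## Functions and one-forms inside the algebra of differential forms -/

section Forms

variable {A B : Type} [Ring A] [Algebra ℂ A] [Ring B] [Algebra ℂ B] (ρ : A →ₐ[ℂ] B) (F : B)

/-! Write `p = q²`, `w = z∗`, `b = β`. The defining relation gives `[w, z] = (1 - p) b y`, so `dz`
and `dw` are scalar multiples of `y e₀` and `y e₁`, where `e₀`, `e₁` are the lower left and upper
right matrix units. As `y` is invertible, `Γ` consists of all off-diagonal matrices; it is a free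
left module on `e₀, e₁`, and these commute with functions.

In the universal calculus, the expressions for `d(z²)`, `d(w²)` and `d(zw)` in terms of `dz`, `dw`
force `e₀² = e₁² = 0` and `e₀e₁ = -p⁻¹ e₁e₀`, so the two-forms are generated by `ω = p⁻¹ e₁e₀`,
which commutes with functions. That no further relations occur is seen in a model by `4 × 4`
matrices, the `p`-deformed exterior algebra (`wedge_relation`, `modelGen_rel`): if `∑ aᵢ dbᵢ = 0`,
then the coefficient of `∑ daᵢ ∧ dbᵢ` vanishes because `wz - pzw` is a scalar. Hence `π(da ∧ db) =
(1 - p)⁻² ([w,a][z,b] - p[z,a][w,b])`, which is `wedgeCoeff`.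

Since `[z, ·]` and `[w, ·]` are derivations, `π` satisfies a Hochschild cocycle identity
(`wedgeCoeff_leibniz`). With the twisted trace property of `h` this gives the cocycle equation, and
with `h(π(dx₁ ∧ dx₂)) = 0` (`wedgeCoeff_eq_zero`) it gives cyclicity. The commutator formula is a
product of `2 × 2` matrices: the weights `q²` and `-1` of the grading reproduce the two terms of
`-π`.

The analysis rests on `y` being diagonal with positive eigenvalues `λₙ` such that `min(λₙ, λₙ⁻¹)` is
summable. For `x ∈ X_c` boundedness of `xy` and `xy⁻¹` gives `‖x eₙ‖ ≤ C min(λₙ, λₙ⁻¹)`, hence trace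
class closures and, by Fubini, a trace on `X_c`. Although `z` may be unbounded, `z∗z` and `zz∗` are
affine in `y`, so multiplication by `z` and `z∗` preserves `X_c`. -/

theorem dif_mul (a b : A) : dif ρ F (a * b) = dif ρ F a * ρ b + ρ a * dif ρ F b := by
  simp only [dif, map_mul]; noncomm_ring

theorem dif_one : dif ρ F 1 = 0 := by simp [dif]

theorem dif_smul (c : ℂ) (a : A) : dif ρ F (c • a) = c • dif ρ F a := by
  simp only [dif, map_smul, mul_smul_comm, smul_mul_assoc, smul_sub]
  module

namespace Forms

theorem fn_add (a b : A) : fn ρ F (a + b) = fn ρ F a + fn ρ F b := by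
  simpa [fn] using RingQuot.mkAlgHom_rel ℂ (FormRel.fn_add (ρ := ρ) (F := F) a b)

theorem fn_smul (c : ℂ) (a : A) : fn ρ F (c • a) = c • fn ρ F a := by
  simpa [fn] using RingQuot.mkAlgHom_rel ℂ (FormRel.fn_smul (ρ := ρ) (F := F) c a)

theorem fn_one : fn ρ F 1 = 1 := by
  simpa [fn] using RingQuot.mkAlgHom_rel ℂ (FormRel.fn_one (ρ := ρ) (F := F))

theorem fn_mul (a b : A) : fn ρ F (a * b) = fn ρ F a * fn ρ F b := by
  simpa [fn] using RingQuot.mkAlgHom_rel ℂ (FormRel.fn_mul (ρ := ρ) (F := F) a b)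

/-- The inclusion of the functions into the differential forms, as an algebra homomorphism. -/
def fnHom : A →ₐ[ℂ] Forms ρ F :=
  AlgHom.ofLinearMap ⟨⟨fn ρ F, fn_add ρ F⟩, fn_smul ρ F⟩ (fn_one ρ F) (fn_mul ρ F)

theorem fn_eq (a : A) : fn ρ F a = fnHom ρ F a := rfl

theorem one_add (g g' : OneForm ρ F) : one ρ F (g + g') = one ρ F g + one ρ F g' := by
  simpa [one] using RingQuot.mkAlgHom_rel ℂ (FormRel.form_add g g')

theorem one_smul (c : ℂ) (g : OneForm ρ F) : one ρ F (c • g) = c • one ρ F g := by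
  simpa [one] using RingQuot.mkAlgHom_rel ℂ (FormRel.form_smul c g)

theorem one_lmul (a : A) (g : OneForm ρ F) :
    one ρ F (OneForm.lmul ρ F a g) = fn ρ F a * one ρ F g := by
  simpa [one, fn] using RingQuot.mkAlgHom_rel ℂ (FormRel.left a g)

theorem one_rmul (g : OneForm ρ F) (a : A) :
    one ρ F (OneForm.rmul ρ F g a) = one ρ F g * fn ρ F a := by
  simpa [one, fn] using RingQuot.mkAlgHom_rel ℂ (FormRel.right g a)

theorem d_one : d ρ F 1 = 0 := by
  -- Scaling the zero one-form by `0` shows that its image in the forms is zero.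
  have h := one_smul ρ F 0 0
  rw [zero_smul, zero_smul] at h
  rw [← h, d]
  congr 1
  exact Subtype.ext (dif_one ρ F)

theorem d_smul (c : ℂ) (a : A) : d ρ F (c • a) = c • d ρ F a := by
  rw [d, d, ← one_smul]
  congr 1
  exact Subtype.ext (dif_smul ρ F c a)

theorem sum_d_mul_d_eq_zero {n : ℕ} (a b : Fin n → A) (h : ∑ i, ρ (a i) * dif ρ F (b i) = 0) :
    ∑ i, d ρ F (a i) * d ρ F (b i) = 0 := by
  simpa [one, d] using RingQuot.mkAlgHom_rel ℂ (FormRel.wedge a b h)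

end Forms

end Forms

/-! ## The calculus of a pair `z, w` with `wz - pzw` a scalar -/

section Plane

variable {A : Type} [Ring A] [Algebra ℂ A]

/-- The elements `z, w` satisfy `wz - pzw = a(1 - p)`, and `y = b(a - zw)` with `b = ±1` is
invertible. -/
structure IsQuantumPlane (p a b : ℂ) (z w y yi : A) : Prop where
  ne_zero : p ≠ 0
  ne_one : 1 - p ≠ 0
  ne_neg_one : 1 + p ≠ 0
  sq : b * b = 1
  rel : w * z - p • (z * w) = algebraMap ℂ A (a * (1 - p))
  y_eq : y = b • (algebraMap ℂ A a - z * w)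
  mul_inv : y * yi = 1
  inv_mul : yi * y = 1

/-- The algebra homomorphism `x ↦ diag(x, x)`. -/
abbrev diagHom (A : Type) [Ring A] [Algebra ℂ A] : A →ₐ[ℂ] Matrix (Fin 2) (Fin 2) A :=
  Matrix.scalarAlgHom (Fin 2) ℂ

/-- The operator `(1 - p)⁻¹` times the matrix with off-diagonal entries `z` and `w`. -/
abbrev offDiag (p : ℂ) (z w : A) : Matrix (Fin 2) (Fin 2) A := (1 - p)⁻¹ • !![0, z; w, 0]

theorem diagHom_apply (x : A) : diagHom A x = !![x, 0; 0, x] := by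
  ext i j; fin_cases i <;> fin_cases j <;> simp [diagHom]

theorem dif_offDiag (p : ℂ) (z w x : A) : dif (diagHom A) (offDiag p z w) x =
    (Complex.I * (1 - p)⁻¹) • !![0, z * x - x * z; w * x - x * w, 0] := by
  rw [dif, diagHom_apply]
  ext i j
  fin_cases i <;> fin_cases j <;>
    simp [smul_smul, smul_sub]

/-- The coefficient of `da ∧ db` with respect to the volume form. -/
def wedgeCoeff (p : ℂ) (z w a b : A) : A :=
  ((1 - p)⁻¹ ^ 2) • ((w * a - a * w) * (z * b - b * z) - p • ((z * a - a * z) * (w * b - b * w)))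

/-! ### Commutation rules and the free bimodule of one-forms -/

namespace IsQuantumPlane

variable {p a b : ℂ} {z w y yi : A} (H : IsQuantumPlane p a b z w y yi)
include H

theorem zw : z * w = algebraMap ℂ A a - b • y := by
  rw [H.y_eq, smul_smul, H.sq, one_smul, sub_sub_cancel]

theorem wz : w * z = algebraMap ℂ A a - (p * b) • y := by
  have h := H.rel
  rw [sub_eq_iff_eq_add, H.zw] at h
  rw [h]
  simp only [Algebra.algebraMap_eq_smul_one]
  module

/-- Both bracketings of `z w z` are compared after inserting `zw = a - by` and `wz = a - pby`. -/
theorem y_z : y * z = p • (z * y) := by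
  have h : z * (w * z) = z * w * z := (mul_assoc _ _ _).symm
  rw [H.wz, H.zw] at h
  simp only [Algebra.algebraMap_eq_smul_one, mul_sub, sub_mul, mul_smul_comm, smul_mul_assoc,
    mul_one, one_mul, sub_right_inj] at h
  have h2 := congrArg (b • ·) h
  simp only [smul_smul] at h2
  rw [H.sq, one_smul, mul_comm p b, ← mul_assoc, H.sq, one_mul] at h2
  exact h2.symm

theorem w_y : w * y = p • (y * w) := by
  have h : w * (z * w) = w * z * w := (mul_assoc _ _ _).symm
  rw [H.wz, H.zw] at h
  simp only [Algebra.algebraMap_eq_smul_one, mul_sub, sub_mul, mul_smul_comm, smul_mul_assoc,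
    mul_one, one_mul, sub_right_inj] at h
  have h2 := congrArg (b • ·) h
  simp only [smul_smul] at h2
  rwa [H.sq, one_smul, mul_comm p b, ← mul_assoc, H.sq, one_mul] at h2

theorem y_w : y * w = p⁻¹ • (w * y) := by
  rw [H.w_y, smul_smul, inv_mul_cancel₀ H.ne_zero, one_smul]

theorem z_yi : z * yi = p • (yi * z) := by
  have h : yi * (y * z) * yi = yi * (p • (z * y)) * yi := by rw [H.y_z]
  simpa only [← mul_assoc, H.inv_mul, one_mul, mul_smul_comm, smul_mul_assoc,
    mul_assoc _ y yi, H.mul_inv, mul_one] using h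

theorem yi_w : yi * w = p • (w * yi) := by
  have h : yi * (w * y) * yi = yi * (p • (y * w)) * yi := by rw [H.w_y]
  simpa only [← mul_assoc, H.inv_mul, one_mul, mul_smul_comm, smul_mul_assoc,
    mul_assoc _ y yi, H.mul_inv, mul_one] using h

theorem comm_wz : w * z - z * w = ((1 - p) * b) • y := by
  rw [H.wz, H.zw]; module

/-- One entry is `[z, z] = 0`; in the other the factor `1 - p` of `[w, z]` cancels the normalization
of the off-diagonal operator. -/
theorem dif_z : dif (diagHom A) (offDiag p z w) z = (Complex.I * b) • !![0, 0; y, 0] := by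
  rw [dif_offDiag, H.comm_wz]
  have := H.ne_one
  ext i j
  fin_cases i <;> fin_cases j <;> simp [smul_smul]
  congr 1
  field_simp

theorem dif_w : dif (diagHom A) (offDiag p z w) w = (-(Complex.I * b)) • !![0, y; 0, 0] := by
  rw [dif_offDiag, ← neg_sub (w * z), H.comm_wz]
  have := H.ne_one
  ext i j
  fin_cases i <;> fin_cases j <;> simp [smul_smul]
  congr 1
  field_simp

theorem dif_z_mul_z : dif (diagHom A) (offDiag p z w) z * diagHom A z =
    p • (diagHom A z * dif (diagHom A) (offDiag p z w) z) := by
  rw [H.dif_z, diagHom_apply]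
  ext i j
  fin_cases i <;> fin_cases j <;> simp [Matrix.mul_apply, Fin.sum_univ_two]
  rw [H.y_z]; module

theorem dif_z_mul_w : dif (diagHom A) (offDiag p z w) z * diagHom A w =
    p⁻¹ • (diagHom A w * dif (diagHom A) (offDiag p z w) z) := by
  rw [H.dif_z, diagHom_apply]
  ext i j
  fin_cases i <;> fin_cases j <;> simp [Matrix.mul_apply, Fin.sum_univ_two]
  rw [H.y_w]; module

theorem dif_w_mul_z : dif (diagHom A) (offDiag p z w) w * diagHom A z =
    p • (diagHom A z * dif (diagHom A) (offDiag p z w) w) := by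
  rw [H.dif_w, diagHom_apply]
  ext i j
  fin_cases i <;> fin_cases j <;> simp [Matrix.mul_apply, Fin.sum_univ_two]
  rw [H.y_z]; module

theorem dif_w_mul_w : dif (diagHom A) (offDiag p z w) w * diagHom A w =
    p⁻¹ • (diagHom A w * dif (diagHom A) (offDiag p z w) w) := by
  rw [H.dif_w, diagHom_apply]
  ext i j
  fin_cases i <;> fin_cases j <;> simp [Matrix.mul_apply, Fin.sum_univ_two]
  rw [H.y_w]; module

theorem combination_eq (r s : A) : diagHom A r * dif (diagHom A) (offDiag p z w) z +
    diagHom A s * dif (diagHom A) (offDiag p z w) w =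
      !![0, -(Complex.I * b) • (s * y); (Complex.I * b) • (r * y), 0] := by
  rw [H.dif_z, H.dif_w, diagHom_apply, diagHom_apply]
  ext i j
  fin_cases i <;> fin_cases j <;> simp

/-- Makes the coefficients `ib` of `dz` and `-ib` of `dw` inverse to each other, so that solving for
one-form coefficients needs no division. -/
theorem I_mul_b : Complex.I * b * -(Complex.I * b) = 1 := by
  linear_combination -b * b * Complex.I_mul_I + H.sq

theorem offDiag_combination (r s : A) :
    (!![0, s; r, 0] : Matrix (Fin 2) (Fin 2) A) =
      diagHom A (-(Complex.I * b) • (r * yi)) * dif (diagHom A) (offDiag p z w) z +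
      diagHom A ((Complex.I * b) • (s * yi)) * dif (diagHom A) (offDiag p z w) w := by
  have h := H.I_mul_b
  rw [H.combination_eq, smul_mul_assoc, smul_mul_assoc, mul_assoc, mul_assoc, H.inv_mul, mul_one,
    mul_one, smul_smul, smul_smul, h, mul_comm, h, one_smul, one_smul]

/-- With `eq_offDiag` this identifies the first order calculus with the space of all off-diagonal
matrices. -/
theorem offDiag_mem (r s : A) : !![0, s; r, 0] ∈ OneForm (diagHom A) (offDiag p z w) := by
  rw [H.offDiag_combination]
  exact add_mem (Submodule.subset_span ⟨_, _, rfl⟩) (Submodule.subset_span ⟨_, _, rfl⟩)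

omit H in
theorem eq_offDiag {g : Matrix (Fin 2) (Fin 2) A} (hg : g ∈ OneForm (diagHom A) (offDiag p z w)) :
    g = !![0, g 0 1; g 1 0, 0] := by
  induction hg using Submodule.span_induction with
  | mem x h =>
    obtain ⟨r, s, rfl⟩ := h
    rw [dif_offDiag, diagHom_apply]
    ext i j
    fin_cases i <;> fin_cases j <;> simp [Matrix.mul_apply, Fin.sum_univ_two]
  | zero => ext i j; fin_cases i <;> fin_cases j <;> simp
  | add x y _ _ hx hy =>
    rw [hx, hy]; ext i j; fin_cases i <;> fin_cases j <;> simp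
  | smul c x _ hx => rw [hx]; ext i j; fin_cases i <;> fin_cases j <;> simp

theorem existsUnique_combination {g : Matrix (Fin 2) (Fin 2) A}
    (hg : g ∈ OneForm (diagHom A) (offDiag p z w)) :
    ∃! r : A × A, g = diagHom A r.1 * dif (diagHom A) (offDiag p z w) z +
      diagHom A r.2 * dif (diagHom A) (offDiag p z w) w := by
  refine ⟨(-(Complex.I * b) • (g 1 0 * yi), (Complex.I * b) • (g 0 1 * yi)), ?_, ?_⟩
  · exact (eq_offDiag hg).trans (H.offDiag_combination _ _)
  · rintro ⟨r, s⟩ h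
    have hI := H.I_mul_b
    rw [H.combination_eq] at h
    have h1 : g 1 0 = (Complex.I * b) • (r * y) := by rw [h]; simp
    have h2 : g 0 1 = -(Complex.I * b) • (s * y) := by rw [h]; simp
    rw [h1, h2]
    simp only [smul_mul_assoc, mul_assoc _ y yi, H.mul_inv, mul_one, smul_smul]
    rw [hI, mul_comm (-(Complex.I * b)), hI, one_smul, one_smul]

end IsQuantumPlane

/-! ### A matrix model of the algebra of differential forms -/

/-- The left multiplication by the one-form `r e₀ + s e₁` in the `p`-deformed exterior algebra of
rank two, in the basis `1, e₀, e₁, e₀e₁`. -/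
def modelForm (p : ℂ) (r s : A) : Matrix (Fin 4) (Fin 4) A :=
  !![0, 0, 0, 0; r, 0, 0, 0; s, 0, 0, 0; 0, -(p • s), r, 0]

theorem modelForm_add (p : ℂ) (r s r' s' : A) :
    modelForm p (r + r') (s + s') = modelForm p r s + modelForm p r' s' := by
  ext i j; fin_cases i <;> fin_cases j <;> simp [modelForm, smul_add]; abel

theorem modelForm_smul (p c : ℂ) (r s : A) :
    modelForm p (c • r) (c • s) = c • modelForm p r s := by
  ext i j; fin_cases i <;> fin_cases j <;> simp [modelForm, smul_comm c p s]

theorem scalar_mul_modelForm (p : ℂ) (x r s : A) :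
    Matrix.scalarAlgHom (Fin 4) ℂ x * modelForm p r s = modelForm p (x * r) (x * s) := by
  ext i j; fin_cases i <;> fin_cases j <;> simp [modelForm]

theorem modelForm_mul_scalar (p : ℂ) (x r s : A) :
    modelForm p r s * Matrix.scalarAlgHom (Fin 4) ℂ x = modelForm p (r * x) (s * x) := by
  ext i j; fin_cases i <;> fin_cases j <;> simp [modelForm, Matrix.mul_apply, Fin.sum_univ_four]

theorem modelForm_mul (p : ℂ) (r s r' s' : A) :
    modelForm p r s * modelForm p r' s' =
      Matrix.single 3 0 (r * s' - p • (s * r')) := by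
  ext i j
  fin_cases i <;> fin_cases j <;>
    simp [modelForm, Matrix.mul_apply, Fin.sum_univ_four]
  abel

/-- The matrix model on generators. -/
def modelGen (p : ℂ) (z w : A) :
    A ⊕ OneForm (diagHom A) (offDiag p z w) → Matrix (Fin 4) (Fin 4) A :=
  Sum.elim (Matrix.scalarAlgHom (Fin 4) ℂ) fun g => modelForm p (g.1 1 0) (g.1 0 1)

namespace IsQuantumPlane

variable {p a b : ℂ} {z w y yi : A} (H : IsQuantumPlane p a b z w y yi)
include H

/-- The key identity is a twisted form of `d² = 0`: the `i`-th summand equals a `p`-twisted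
commutator of `z, w` with `rᵢ[z, sᵢ]` and `rᵢ[w, sᵢ]`. The leftover terms `rᵢ(wz - pzw)sᵢ` and
`rᵢsᵢ(wz - pzw)` cancel because `wz - pzw` is a scalar. -/
theorem wedge_relation {n : ℕ} (r s : Fin n → A)
    (hw : ∑ i, r i * (w * s i - s i * w) = 0) (hz : ∑ i, r i * (z * s i - s i * z) = 0) :
    ∑ i, ((w * r i - r i * w) * (z * s i - s i * z) -
      p • ((z * r i - r i * z) * (w * s i - s i * w))) = 0 := by
  have h0 : w * z = p • (z * w) + (a * (1 - p)) • (1 : A) := by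
    rw [← Algebra.algebraMap_eq_smul_one, ← H.rel]; abel
  have key : ∀ i, (w * r i - r i * w) * (z * s i - s i * z) -
      p • ((z * r i - r i * z) * (w * s i - s i * w)) =
      w * (r i * (z * s i - s i * z)) - p • (z * (r i * (w * s i - s i * w))) +
        (r i * (w * s i - s i * w)) * z - p • ((r i * (z * s i - s i * z)) * w) := by
    intro i
    have h1 : r i * (w * (z * s i)) = p • (r i * (z * (w * s i))) + (a * (1 - p)) • (r i * s i) := by
      rw [← mul_assoc w, h0]
      simp only [add_mul, smul_mul_assoc, one_mul, mul_add, mul_smul_comm, mul_assoc]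
    have h2 : r i * (s i * (w * z)) = p • (r i * (s i * (z * w))) + (a * (1 - p)) • (r i * s i) := by
      rw [h0]
      simp only [mul_add, mul_smul_comm, mul_one]
    simp only [mul_sub, sub_mul, mul_assoc, smul_sub, h1, h2]
    module
  simp only [key, Finset.sum_add_distrib, Finset.sum_sub_distrib, ← Finset.mul_sum,
    ← Finset.smul_sum, ← Finset.sum_mul, hw, hz]
  simp

/-- The matrix model respects the relations of the algebra of differential forms. -/
theorem modelGen_rel {x x' : FreeAlgebra ℂ (A ⊕ OneForm (diagHom A) (offDiag p z w))}
    (h : FormRel (diagHom A) (offDiag p z w) x x') :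
    FreeAlgebra.lift ℂ (modelGen p z w) x = FreeAlgebra.lift ℂ (modelGen p z w) x' := by
  cases h with
  | fn_add r s => simp only [map_add, FreeAlgebra.lift_ι_apply, modelGen, Sum.elim_inl]
  | fn_smul c r => simp only [map_smul, FreeAlgebra.lift_ι_apply, modelGen, Sum.elim_inl]
  | fn_one => simp only [map_one, FreeAlgebra.lift_ι_apply, modelGen, Sum.elim_inl]
  | fn_mul r s => simp only [map_mul, FreeAlgebra.lift_ι_apply, modelGen, Sum.elim_inl]
  | form_add g g' =>
    simp only [map_add, FreeAlgebra.lift_ι_apply, modelGen, Sum.elim_inr]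
    exact modelForm_add _ _ _ _ _
  | form_smul c g =>
    simp only [map_smul, FreeAlgebra.lift_ι_apply, modelGen, Sum.elim_inr]
    exact modelForm_smul _ _ _ _
  | left r g =>
    simp only [map_mul, FreeAlgebra.lift_ι_apply, modelGen, Sum.elim_inr, Sum.elim_inl]
    rw [scalar_mul_modelForm]
    simp [OneForm.lmul]
  | right g r =>
    simp only [map_mul, FreeAlgebra.lift_ι_apply, modelGen, Sum.elim_inr, Sum.elim_inl]
    rw [modelForm_mul_scalar]
    simp [OneForm.rmul]
  | wedge r s h =>
    simp only [map_mul, map_sum, map_zero, FreeAlgebra.lift_ι_apply, modelGen, Sum.elim_inr,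
      OneForm.d, dif_offDiag, modelForm_mul]
    have hc : Complex.I * (1 - p)⁻¹ ≠ 0 := mul_ne_zero Complex.I_ne_zero (inv_ne_zero H.ne_one)
    simp only [dif_offDiag, mul_smul_comm, ← Finset.smul_sum, smul_eq_zero, hc, false_or] at h
    -- The two off-diagonal entries of `∑ rᵢ dsᵢ = 0`.
    have hz : ∑ i, r i * (z * s i - s i * z) = 0 := by
      have := congrFun (congrFun h 0) 1
      simpa [Matrix.sum_apply, diagHom_apply, Matrix.mul_apply, Fin.sum_univ_two] using this
    have hw : ∑ i, r i * (w * s i - s i * w) = 0 := by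
      have := congrFun (congrFun h 1) 0
      simpa [Matrix.sum_apply, diagHom_apply, Matrix.mul_apply, Fin.sum_univ_two] using this
    have hs := H.wedge_relation r s hw hz
    ext i j
    -- A product of two one-forms sends `1` to a multiple of `e₀e₁` and kills the other basis
    -- vectors, so only this entry carries information.
    by_cases hij : (3 : Fin 4) = i ∧ (0 : Fin 4) = j
    · obtain ⟨rfl, rfl⟩ := hij
      have hs2 := congrArg (((Complex.I * (1 - p)⁻¹) * (Complex.I * (1 - p)⁻¹)) • ·) hs
      simp only [smul_zero, Finset.smul_sum] at hs2
      simp only [Matrix.sum_apply, Matrix.single_apply_same, Matrix.zero_apply]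
      rw [← hs2]
      refine Finset.sum_congr rfl fun i _ => ?_
      simp only [Matrix.smul_apply, Matrix.of_apply, Matrix.cons_val', Matrix.cons_val_zero,
        Matrix.cons_val_one, Matrix.cons_val_fin_one, smul_mul_assoc, mul_smul_comm]
      module
    · rw [Matrix.sum_apply]
      simp [Matrix.single_apply_of_ne _ _ _ _ _ hij]

/-- The matrix model of the algebra of differential forms. -/
def model : Forms (diagHom A) (offDiag p z w) →ₐ[ℂ] Matrix (Fin 4) (Fin 4) A :=
  RingQuot.liftAlgHom ℂ ⟨FreeAlgebra.lift ℂ (modelGen p z w), fun _ _ h => H.modelGen_rel h⟩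

theorem model_fn (x : A) :
    H.model (Forms.fn (diagHom A) (offDiag p z w) x) = Matrix.scalarAlgHom (Fin 4) ℂ x := by
  rw [model, Forms.fn, RingQuot.liftAlgHom_mkAlgHom_apply, FreeAlgebra.lift_ι_apply]
  rfl

theorem model_one (g : OneForm (diagHom A) (offDiag p z w)) :
    H.model (Forms.one (diagHom A) (offDiag p z w) g) = modelForm p (g.1 1 0) (g.1 0 1) := by
  rw [model, Forms.one, RingQuot.liftAlgHom_mkAlgHom_apply, FreeAlgebra.lift_ι_apply]
  rfl

/-! ### The two-forms -/

/-- The one-form with matrix entries `s, r` off the diagonal. -/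
def form (r s : A) : Forms (diagHom A) (offDiag p z w) :=
  Forms.one _ _ ⟨!![0, s; r, 0], H.offDiag_mem r s⟩

theorem one_eq_form (g : OneForm (diagHom A) (offDiag p z w)) :
    Forms.one _ _ g = H.form (g.1 1 0) (g.1 0 1) :=
  congrArg _ (Subtype.ext (eq_offDiag g.2))

theorem form_add (r s r' s' : A) : H.form (r + r') (s + s') = H.form r s + H.form r' s' := by
  rw [form, form, form, ← Forms.one_add]
  congr 1
  refine Subtype.ext ?_
  change _ = !![0, s; r, 0] + !![0, s'; r', 0]
  simp

theorem fn_mul_form (x r s : A) : Forms.fn _ _ x * H.form r s = H.form (x * r) (x * s) := by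
  rw [form, form, ← Forms.one_lmul]
  congr 1
  ext i j; fin_cases i <;> fin_cases j <;> simp [OneForm.lmul]

theorem form_mul_fn (x r s : A) : H.form r s * Forms.fn _ _ x = H.form (r * x) (s * x) := by
  rw [form, form, ← Forms.one_rmul]
  congr 1
  ext i j
  fin_cases i <;> fin_cases j <;>
    simp [OneForm.rmul]

theorem form_eq (r s : A) :
    H.form r s = Forms.fn _ _ r * H.form 1 0 + Forms.fn _ _ s * H.form 0 1 := by
  rw [fn_mul_form, fn_mul_form, ← form_add, mul_one, mul_zero, mul_one, mul_zero, add_zero,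
    zero_add]

theorem d_eq (x : A) : Forms.d (diagHom A) (offDiag p z w) x =
    (Complex.I * (1 - p)⁻¹) • H.form (w * x - x * w) (z * x - x * z) := by
  rw [Forms.d, form, ← Forms.one_smul]
  congr 1
  exact Subtype.ext (dif_offDiag p z w x)

theorem d_z_eq : Forms.d (diagHom A) (offDiag p z w) z =
    (Complex.I * b) • (Forms.fn _ _ y * H.form 1 0) := by
  rw [fn_mul_form, form, ← Forms.one_smul, Forms.d]
  congr 1
  refine Subtype.ext (H.dif_z.trans ?_)
  change _ = (Complex.I * b) • !![0, y * 0; y * 1, 0]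
  simp

theorem d_w_eq : Forms.d (diagHom A) (offDiag p z w) w =
    (-(Complex.I * b)) • (Forms.fn _ _ y * H.form 0 1) := by
  rw [fn_mul_form, form, ← Forms.one_smul, Forms.d]
  congr 1
  refine Subtype.ext (H.dif_w.trans ?_)
  change _ = (-(Complex.I * b)) • !![0, y * 1; y * 0, 0]
  simp

/-- `d(z²) = (1 + p) z dz`, so `1 · d(z²) - (1 + p) z dz = 0` is a relation in `Γ`. Its wedge
relation is `(1 + p) dz ∧ dz = 0`, as `d1 = 0`. -/
theorem d_z_mul_d_z :
    Forms.d (diagHom A) (offDiag p z w) z * Forms.d (diagHom A) (offDiag p z w) z = 0 := by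
  have h := Forms.sum_d_mul_d_eq_zero (diagHom A) (offDiag p z w) ![1, -(1 + p) • z] ![z * z, z] (by
    rw [Fin.sum_univ_two]
    simp only [Matrix.cons_val_zero, Matrix.cons_val_one, dif_mul, map_one, one_mul,
      H.dif_z_mul_z, map_smul, smul_mul_assoc]
    module)
  rw [Fin.sum_univ_two] at h
  simp only [Matrix.cons_val_zero, Matrix.cons_val_one, Forms.d_one, zero_mul, zero_add,
    Forms.d_smul, smul_mul_assoc] at h
  exact (smul_eq_zero.1 h).resolve_left (neg_ne_zero.2 H.ne_neg_one)

theorem d_w_mul_d_w :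
    Forms.d (diagHom A) (offDiag p z w) w * Forms.d (diagHom A) (offDiag p z w) w = 0 := by
  have h := Forms.sum_d_mul_d_eq_zero (diagHom A) (offDiag p z w) ![1, -(1 + p⁻¹) • w] ![w * w, w]
    (by
      rw [Fin.sum_univ_two]
      simp only [Matrix.cons_val_zero, Matrix.cons_val_one, dif_mul, map_one, one_mul,
        H.dif_w_mul_w, map_smul, smul_mul_assoc]
      module)
  rw [Fin.sum_univ_two] at h
  simp only [Matrix.cons_val_zero, Matrix.cons_val_one, Forms.d_one, zero_mul, zero_add,
    Forms.d_smul, smul_mul_assoc] at h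
  refine (smul_eq_zero.1 h).resolve_left (neg_ne_zero.2 fun h0 => H.ne_neg_one ?_)
  have := H.ne_zero
  field_simp at h0
  linear_combination h0

theorem d_z_mul_d_w :
    Forms.d (diagHom A) (offDiag p z w) z * Forms.d (diagHom A) (offDiag p z w) w =
      (-p⁻¹) • (Forms.d (diagHom A) (offDiag p z w) w * Forms.d (diagHom A) (offDiag p z w) z) := by
  -- The relation in `Γ` is `d(zw) - z dw - p⁻¹ w dz = 0`.
  have h := Forms.sum_d_mul_d_eq_zero (diagHom A) (offDiag p z w)
    ![1, (-1 : ℂ) • z, -p⁻¹ • w] ![z * w, w, z] (by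
      rw [Fin.sum_univ_three]
      simp only [Matrix.cons_val_zero, Matrix.cons_val_one, Matrix.cons_val_two, Matrix.tail_cons,
        Matrix.head_cons, dif_mul, map_one, one_mul,
        H.dif_z_mul_w, map_smul, smul_mul_assoc]
      module)
  rw [Fin.sum_univ_three] at h
  simp only [Matrix.cons_val_zero, Matrix.cons_val_one, Matrix.cons_val, Forms.d_one, zero_mul,
    zero_add, Forms.d_smul, smul_mul_assoc] at h
  rw [← sub_eq_zero, ← neg_eq_zero, ← h]
  module

theorem form_one_zero_comm (x : A) :
    H.form 1 0 * Forms.fn _ _ x = Forms.fn _ _ x * H.form 1 0 := by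
  rw [form_mul_fn, fn_mul_form, one_mul, mul_one, zero_mul, mul_zero]

theorem form_zero_one_comm (x : A) :
    H.form 0 1 * Forms.fn _ _ x = Forms.fn _ _ x * H.form 0 1 := by
  rw [form_mul_fn, fn_mul_form, one_mul, mul_one, zero_mul, mul_zero]

omit H in
-- Strips the factors `y` from the relations among `dz = ib y e₀` and `dw = -ib y e₁`, turning them
-- into relations among `e₀, e₁`.
theorem fn_cancel (H : IsQuantumPlane p a b z w y yi) {η : Forms (diagHom A) (offDiag p z w)}
    (h : Forms.fn _ _ y * (Forms.fn _ _ y * η) = 0) : η = 0 := by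
  have h2 : Forms.fn _ _ yi * (Forms.fn _ _ yi * (Forms.fn _ _ y * (Forms.fn _ _ y * η))) = 0 := by
    rw [h, mul_zero, mul_zero]
  rwa [← mul_assoc (Forms.fn _ _ yi) (Forms.fn _ _ y), ← Forms.fn_mul, H.inv_mul, Forms.fn_one,
    one_mul, ← mul_assoc, ← Forms.fn_mul, H.inv_mul, Forms.fn_one, one_mul] at h2

theorem I_mul_b_ne_zero : Complex.I * b ≠ 0 := fun h => by
  have := H.I_mul_b
  rw [h] at this
  simp at this

theorem form_one_zero_sq : H.form 1 0 * H.form 1 0 = 0 := by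
  have h := H.d_z_mul_d_z
  rw [H.d_z_eq, smul_mul_smul_comm, mul_assoc (Forms.fn _ _ y),
    ← mul_assoc (H.form 1 0), H.form_one_zero_comm, mul_assoc (Forms.fn _ _ y)] at h
  exact H.fn_cancel ((smul_eq_zero.1 h).resolve_left
    (mul_ne_zero H.I_mul_b_ne_zero H.I_mul_b_ne_zero))

theorem form_zero_one_sq : H.form 0 1 * H.form 0 1 = 0 := by
  have h := H.d_w_mul_d_w
  rw [H.d_w_eq, smul_mul_smul_comm, mul_assoc (Forms.fn _ _ y),
    ← mul_assoc (H.form 0 1), H.form_zero_one_comm, mul_assoc (Forms.fn _ _ y)] at h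
  exact H.fn_cancel ((smul_eq_zero.1 h).resolve_left
    (mul_ne_zero (neg_ne_zero.2 H.I_mul_b_ne_zero) (neg_ne_zero.2 H.I_mul_b_ne_zero)))

theorem form_anticomm : H.form 1 0 * H.form 0 1 = (-p⁻¹) • (H.form 0 1 * H.form 1 0) := by
  have h := H.d_z_mul_d_w
  rw [H.d_w_eq, H.d_z_eq, smul_mul_smul_comm, smul_mul_smul_comm,
    mul_assoc (Forms.fn _ _ y), mul_assoc (Forms.fn _ _ y),
    ← mul_assoc (H.form 1 0), H.form_one_zero_comm, mul_assoc (Forms.fn _ _ y),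
    ← mul_assoc (H.form 0 1), H.form_zero_one_comm, mul_assoc (Forms.fn _ _ y),
    mul_comm (-(Complex.I * b)), H.I_mul_b, one_smul, one_smul, ← sub_eq_zero] at h
  rw [← sub_eq_zero]
  refine H.fn_cancel ?_
  simpa only [mul_sub, mul_smul_comm] using h

/-- The volume form `p⁻¹ y⁻² dw ∧ dz`. -/
abbrev volume (p : ℂ) (z w yi : A) : Forms (diagHom A) (offDiag p z w) :=
  p⁻¹ • (Forms.fn _ _ (yi ^ 2) * Forms.d _ _ w * Forms.d _ _ z)

theorem volume_eq : volume p z w yi = p⁻¹ • (H.form 0 1 * H.form 1 0) := by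
  rw [volume, H.d_w_eq, H.d_z_eq, mul_assoc, smul_mul_smul_comm, mul_comm (-(Complex.I * b)),
    H.I_mul_b, one_smul, mul_assoc, ← mul_assoc (H.form 0 1), H.form_zero_one_comm, ← mul_assoc,
    ← mul_assoc, ← mul_assoc, ← Forms.fn_mul, ← Forms.fn_mul, pow_two, mul_assoc yi yi y,
    H.inv_mul, mul_one, H.inv_mul, Forms.fn_one, one_mul]

/-- `e₀` and `e₁` commute with functions and have square zero, while `e₁e₀ = pω` and `e₀e₁ = -ω`. -/
theorem form_mul_form (r s r' s' : A) : H.form r s * H.form r' s' =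
    Forms.fn _ _ (p • (s * r') - r * s') * volume p z w yi := by
  have h1 : ∀ (c d : A) (u v : Forms (diagHom A) (offDiag p z w)),
      u * Forms.fn _ _ d = Forms.fn _ _ d * u →
      Forms.fn _ _ c * u * (Forms.fn _ _ d * v) = Forms.fn _ _ (c * d) * (u * v) := by
    intro c d u v h
    rw [mul_assoc, ← mul_assoc u, h, Forms.fn_mul]
    simp only [mul_assoc]
  rw [H.form_eq r s, H.form_eq r' s', H.volume_eq, add_mul, mul_add, mul_add,
    h1 _ _ _ _ (H.form_one_zero_comm _), h1 _ _ _ _ (H.form_one_zero_comm _),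
    h1 _ _ _ _ (H.form_zero_one_comm _), h1 _ _ _ _ (H.form_zero_one_comm _),
    H.form_one_zero_sq, H.form_zero_one_sq, H.form_anticomm]
  simp only [Forms.fn_eq, map_sub, map_smul, sub_mul, smul_mul_assoc, mul_smul_comm, mul_zero,
    smul_sub]
  rw [inv_smul_smul₀ H.ne_zero]
  module

theorem volume_comm (x : A) :
    volume p z w yi * Forms.fn _ _ x = Forms.fn _ _ x * volume p z w yi := by
  rw [H.volume_eq, smul_mul_assoc, mul_assoc, H.form_one_zero_comm, ← mul_assoc,
    H.form_zero_one_comm, mul_smul_comm, mul_assoc]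

theorem form_mem_twoForm (r s r' s' : A) :
    H.form r s * H.form r' s' ∈ TwoForm (diagHom A) (offDiag p z w) :=
  Submodule.subset_span ⟨_, _, rfl⟩

theorem volume_mem : volume p z w yi ∈ TwoForm (diagHom A) (offDiag p z w) := by
  rw [H.volume_eq]
  exact Submodule.smul_mem _ _ (H.form_mem_twoForm _ _ _ _)

theorem model_volume : H.model (volume p z w yi) = Matrix.single 3 0 (-1) := by
  rw [H.volume_eq, map_smul, map_mul, form, form, H.model_one, H.model_one, modelForm_mul]
  simp [H.ne_zero, smul_smul]

/-- The defining relations alone give no lower bound on the two-forms; in the matrix model the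
coefficient is visible, up to sign, as the entry `(3, 0)`. -/
theorem fn_mul_volume_injective {x x' : A}
    (h : Forms.fn _ _ x * volume p z w yi = Forms.fn _ _ x' * volume p z w yi) : x = x' := by
  have h2 := congrArg H.model h
  rw [map_mul, map_mul, H.model_volume, H.model_fn, H.model_fn] at h2
  simpa using congrFun (congrFun h2 3) 0

theorem existsUnique_coeff {η : Forms (diagHom A) (offDiag p z w)} (hη : η ∈ TwoForm _ _) :
    ∃! x : A, η = Forms.fn _ _ x * volume p z w yi := by
  refine existsUnique_of_exists_of_unique ?_ fun x x' hx hx' =>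
    H.fn_mul_volume_injective (hx.symm.trans hx')
  induction hη using Submodule.span_induction with
  | mem η h =>
    obtain ⟨g, g', rfl⟩ := h
    rw [H.one_eq_form, H.one_eq_form, H.form_mul_form]
    exact ⟨_, rfl⟩
  | zero => exact ⟨0, by rw [Forms.fn_eq, map_zero, zero_mul]⟩
  | add η η' _ _ h h' =>
    obtain ⟨x, rfl⟩ := h
    obtain ⟨x', rfl⟩ := h'
    exact ⟨x + x', by rw [Forms.fn_add, add_mul]⟩
  | smul c η _ h =>
    obtain ⟨x, rfl⟩ := h
    exact ⟨c • x, by rw [Forms.fn_smul, smul_mul_assoc]⟩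

/-- The choice made by `epsilon` solves the equation, and injectivity leaves only one solution. -/
theorem formCoeff_fn_mul (x : A) :
    formCoeff _ _ (volume p z w yi) (Forms.fn _ _ x * volume p z w yi) = x :=
  (H.fn_mul_volume_injective (Classical.epsilon_spec
    (p := fun t => Forms.fn _ _ x * volume p z w yi = Forms.fn _ _ t * volume p z w yi)
    ⟨x, rfl⟩)).symm

theorem d_mul_d (r s : A) : Forms.d _ _ r * Forms.d _ _ s =
    Forms.fn _ _ (wedgeCoeff p z w r s) * volume p z w yi := by
  have hc : Complex.I * (1 - p)⁻¹ * (Complex.I * (1 - p)⁻¹) = -(1 - p)⁻¹ ^ 2 := by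
    linear_combination (1 - p)⁻¹ ^ 2 * Complex.I_mul_I
  rw [H.d_eq, H.d_eq, smul_mul_smul_comm, H.form_mul_form, hc, ← smul_mul_assoc,
    ← Forms.fn_smul, wedgeCoeff]
  congr 2
  module

theorem formCoeff_d_mul_d (r s : A) : formCoeff _ _ (volume p z w yi)
    (Forms.d _ _ r * Forms.d _ _ s) = wedgeCoeff p z w r s := by
  rw [H.d_mul_d, H.formCoeff_fn_mul]

theorem formCoeff_fn_mul_d_mul_d (x r s : A) : formCoeff _ _ (volume p z w yi)
    (Forms.fn _ _ x * Forms.d _ _ r * Forms.d _ _ s) = x * wedgeCoeff p z w r s := by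
  rw [mul_assoc, H.d_mul_d, ← mul_assoc, ← Forms.fn_mul, H.formCoeff_fn_mul]

end IsQuantumPlane

end Plane

/-! ## Twisted cyclic cocycles from a trace -/

section Cocycle

variable {A : Type} [Ring A] [Algebra ℂ A]

/-- The subalgebra `S` is stable under left and right multiplication by `x`. -/
structure IsMulStable (S : NonUnitalSubalgebra ℂ A) (x : A) : Prop where
  left : ∀ s ∈ S, x * s ∈ S
  right : ∀ s ∈ S, s * x ∈ S

/-- `T` is a trace on the subalgebra `S`, and `S` is stable under multiplication by the given
elements. -/
structure IsCoreTrace (S : NonUnitalSubalgebra ℂ A) (T : A →ₗ[ℂ] ℂ) (z w y yi : A) : Prop where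
  z : IsMulStable S z
  w : IsMulStable S w
  y : IsMulStable S y
  yi : IsMulStable S yi
  comm : ∀ r ∈ S, ∀ s ∈ S, T (r * s) = T (s * r)

/-- Each of the two terms is a product of a derivation of the first argument and a derivation of the
second, and such a product is a Hochschild 2-cocycle. -/
theorem wedgeCoeff_leibniz (p : ℂ) (z w r x s : A) :
    r * wedgeCoeff p z w x s =
      wedgeCoeff p z w (r * x) s - wedgeCoeff p z w r (x * s) + wedgeCoeff p z w r x * s := by
  simp only [wedgeCoeff, smul_mul_assoc, mul_smul_comm, ← smul_add, ← smul_sub]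
  congr 1
  simp only [mul_sub, sub_mul, mul_assoc, smul_sub, smul_mul_assoc, mul_smul_comm]
  module

theorem wedgeCoeff_mem {S : NonUnitalSubalgebra ℂ A} {z w : A} (hz : IsMulStable S z)
    (hw : IsMulStable S w) (p : ℂ) {r s : A} (hr : r ∈ S) (hs : s ∈ S) :
    wedgeCoeff p z w r s ∈ S :=
  SMulMemClass.smul_mem _ (sub_mem (mul_mem (sub_mem (hw.left r hr) (hw.right r hr))
      (sub_mem (hz.left s hs) (hz.right s hs)))
    (SMulMemClass.smul_mem _ (mul_mem (sub_mem (hz.left r hr) (hz.right r hr))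
      (sub_mem (hw.left s hs) (hw.right s hs)))))

/-- The trilinear form `(x₀, x₁, x₂) ↦ T (yi x₀ π(dx₁ ∧ dx₂))` on the subalgebra. -/
def wedgeCocycle (S : NonUnitalSubalgebra ℂ A) (T : A →ₗ[ℂ] ℂ) (p : ℂ) (z w yi : A) :
    MultilinearMap ℂ (fun _ : Fin (2 + 1) => S) ℂ where
  toFun x := T (yi * ((x 0 : A) * wedgeCoeff p z w (x 1) (x 2)))
  map_update_add' x i r s := by
    have h10 : (1 : Fin 3) ≠ 0 := Fin.ne_of_val_ne (by norm_num)
    have h20 : (2 : Fin 3) ≠ 0 := Fin.ne_of_val_ne (by norm_num)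
    have h21 : (2 : Fin 3) ≠ 1 := Fin.ne_of_val_ne (by norm_num)
    rw [← map_add]
    congr 1
    fin_cases i <;>
      simp [wedgeCoeff, h10, h20, h21, h10.symm, h20.symm, h21.symm, Function.update_of_ne] <;>
      simp only [mul_add, add_mul, mul_sub, sub_mul, smul_add, smul_sub, mul_smul_comm] <;>
      abel
  map_update_smul' x i c r := by
    have h10 : (1 : Fin 3) ≠ 0 := Fin.ne_of_val_ne (by norm_num)
    have h20 : (2 : Fin 3) ≠ 0 := Fin.ne_of_val_ne (by norm_num)
    have h21 : (2 : Fin 3) ≠ 1 := Fin.ne_of_val_ne (by norm_num)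
    rw [← map_smul]
    congr 1
    fin_cases i <;>
      simp [wedgeCoeff, h10, h20, h21, h10.symm, h20.symm, h21.symm, Function.update_of_ne] <;>
      simp only [mul_sub, sub_mul, smul_sub, mul_smul_comm, smul_mul_assoc] <;>
      module

namespace IsCoreTrace

variable {S : NonUnitalSubalgebra ℂ A} {T : A →ₗ[ℂ] ℂ} {z w y yi : A}
  (h : IsCoreTrace S T z w y yi)
include h

/-- The multiplier `x` need not lie in `S`, so it is moved around in two applications of the trace
property, attached to an element of `S` each time. -/
theorem rotate {x : A} (hx : IsMulStable S x) {r s : A} (hr : r ∈ S) (hs : s ∈ S) :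
    T (r * (s * x)) = T (x * (r * s)) := by
  rw [h.comm r hr _ (hx.right s hs), mul_assoc, h.comm s hs _ (hx.left r hr), mul_assoc]

/-- The twist by `y` cancels against `yi`, which leaves the ordinary trace property for `s` and `yi
r`. -/
theorem twisted {p a b : ℂ} (H : IsQuantumPlane p a b z w y yi) {r s : A} (hr : r ∈ S)
    (hs : s ∈ S) : T (yi * (r * s)) = T (yi * (y * s * yi * r)) := by
  have h1 : yi * (y * s * yi * r) = s * (yi * r) := by
    simp only [← mul_assoc, H.inv_mul, one_mul]
  rw [h1, h.comm s hs _ (h.yi.left r hr), mul_assoc]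

/-- In the eight expanded terms every trailing `z` or `w` is rotated to the front and moved past
`yi`, which costs `p` or `p⁻¹`. Four terms cancel in pairs; the others combine into `yi(wz - pzw)rs
- yi r(wz - pzw)s`, which vanishes since `wz - pzw` is a scalar. -/
theorem wedgeCoeff_eq_zero {p a b : ℂ} (H : IsQuantumPlane p a b z w y yi) {r s : A} (hr : r ∈ S)
    (hs : s ∈ S) : T (yi * wedgeCoeff p z w r s) = 0 := by
  have hp := H.ne_zero
  have hz : ∀ x, z * (yi * x) = p • (yi * (z * x)) := fun x => by
    rw [← mul_assoc, H.z_yi, smul_mul_assoc, mul_assoc]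
  have hw : ∀ x, w * (yi * x) = p⁻¹ • (yi * (w * x)) := fun x => by
    rw [← mul_assoc yi, H.yi_w, smul_mul_assoc, inv_smul_smul₀ hp, mul_assoc]
  have hwz : ∀ x, w * (z * x) = p • (z * (w * x)) + (a * (1 - p)) • x := fun x => by
    have h0 : w * z = p • (z * w) + (a * (1 - p)) • (1 : A) := by
      rw [← Algebra.algebraMap_eq_smul_one, ← H.rel]; abel
    rw [← mul_assoc, h0, add_mul, smul_mul_assoc, smul_mul_assoc, one_mul, mul_assoc]
  have hzr := h.z.left r hr
  have hwr := h.w.left r hr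
  have hrz := h.z.right r hr
  have hrw := h.w.right r hr
  have t1 : T (yi * (w * (r * (s * z)))) = T (z * (yi * (w * (r * s)))) := by
    simpa only [mul_assoc] using h.rotate h.z (h.yi.left _ hwr) hs
  have t2 : T (yi * (r * (w * (s * z)))) = T (z * (yi * (r * (w * s)))) := by
    simpa only [mul_assoc] using h.rotate h.z (h.yi.left _ hrw) hs
  have t3 : T (yi * (z * (r * (s * w)))) = T (w * (yi * (z * (r * s)))) := by
    simpa only [mul_assoc] using h.rotate h.w (h.yi.left _ hzr) hs
  have t4 : T (yi * (r * (z * (s * w)))) = T (w * (yi * (r * (z * s)))) := by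
    simpa only [mul_assoc] using h.rotate h.w (h.yi.left _ hrz) hs
  simp only [wedgeCoeff, mul_smul_comm, map_smul, mul_sub, sub_mul, smul_sub, map_sub, mul_assoc,
    t1, t2, t3, t4, hz, hw, hwz, mul_add, map_add, smul_eq_mul]
  field_simp
  ring

/-- The automorphism `x ↦ y x yi` of the subalgebra. -/
def conjHom {p a b : ℂ} (H : IsQuantumPlane p a b z w y yi) : S →ₙₐ[ℂ] S where
  toFun x := ⟨y * x * yi, h.yi.right _ (h.y.left _ x.2)⟩
  map_smul' c x := Subtype.ext (by simp)
  map_zero' := Subtype.ext (by simp)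
  map_add' r s := Subtype.ext (by simp [mul_add, add_mul])
  map_mul' r s := Subtype.ext (by
    change y * (r * s) * yi = y * r * yi * (y * s * yi)
    simp only [mul_assoc]
    rw [← mul_assoc yi y, H.inv_mul, one_mul])

theorem conjHom_bijective {p a b : ℂ} (H : IsQuantumPlane p a b z w y yi) :
    Function.Bijective (h.conjHom H) := by
  refine Function.bijective_iff_has_inverse.2
    ⟨fun x => ⟨yi * x * y, h.y.right _ (h.yi.left _ x.2)⟩, fun x => Subtype.ext ?_,
      fun x => Subtype.ext ?_⟩
  · change yi * (y * x * yi) * y = x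
    simp only [mul_assoc, H.inv_mul, mul_one]
    rw [← mul_assoc, H.inv_mul, one_mul]
  · change y * (yi * x * y) * yi = x
    simp only [mul_assoc, H.mul_inv, mul_one]
    rw [← mul_assoc, H.mul_inv, one_mul]

theorem isTwistedCyclicCocycle {p a b : ℂ} (H : IsQuantumPlane p a b z w y yi) :
    IsTwistedCyclicCocycle (h.conjHom H) (wedgeCocycle S T p z w yi) where
  bijective := h.conjHom_bijective H
  coboundary_eq_zero x := by
    have h1 : twistedCoboundary (h.conjHom H) (wedgeCocycle S T p z w yi) x =
        T (yi * ((x 0 : A) * x 1 * wedgeCoeff p z w (x 2) (x 3))) -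
        T (yi * ((x 0 : A) * wedgeCoeff p z w (x 1 * x 2) (x 3))) +
        T (yi * ((x 0 : A) * wedgeCoeff p z w (x 1) (x 2 * x 3))) -
        T (yi * (y * x 3 * yi * x 0 * wedgeCoeff p z w (x 1) (x 2))) := by
      rw [twistedCoboundary, Fin.sum_univ_three]
      simp only [sub_eq_add_neg, ← neg_one_mul (T _)]
      have h00 : (-1 : ℂ) ^ ((0 : Fin (2 + 1)) : ℕ) = 1 := rfl
      have h01 : (-1 : ℂ) ^ ((1 : Fin (2 + 1)) : ℕ) = -1 := by simp
      have h02 : (-1 : ℂ) ^ ((2 : Fin (2 + 1)) : ℕ) = 1 := by simp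
      have h03 : (-1 : ℂ) ^ (2 + 1) = -1 := by norm_num
      rw [h00, h01, h02, h03, one_mul, one_mul]
      -- Evaluation of the contracted tuples at concrete indices is definitional.
      rfl
    -- After the Leibniz identity only `T(yi x₀ π(x₁, x₂) x₃)` survives from the first three terms;
    -- the twisted trace property matches it with the last one.
    rw [h1, mul_assoc (x 0 : A), wedgeCoeff_leibniz p z w (x 1 : A),
      mul_assoc (y * (x 3 : A) * yi), ← h.twisted H
        (mul_mem (x 0).2 (wedgeCoeff_mem h.z h.w p (x 1).2 (x 2).2)) (x 3).2]
    simp only [mul_add, mul_sub, map_add, map_sub, mul_assoc]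
    ring
  cyclic x := by
    have h1 : twistedCyclicity (h.conjHom H) (wedgeCocycle S T p z w yi) x =
        T (yi * (y * x 2 * yi * wedgeCoeff p z w (x 0) (x 1))) := by
      rw [twistedCyclicity]
      have h02 : (-1 : ℂ) ^ 2 = 1 := by norm_num
      rw [h02, one_mul]
      rfl
    have h2 : wedgeCocycle S T p z w yi x =
        T (yi * ((x 0 : A) * wedgeCoeff p z w (x 1) (x 2))) := rfl
    -- The twist carries `x₂` to the right of `π(x₀, x₁)`; the Leibniz identity turns this into `x₀
    -- π(x₁, x₂)` up to two exact terms, on which the functional vanishes.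
    rw [h1, h2, ← h.twisted H (wedgeCoeff_mem h.z h.w p (x 0).2 (x 1).2) (x 2).2,
      wedgeCoeff_leibniz, mul_add, mul_sub, map_add, map_sub,
      h.wedgeCoeff_eq_zero H (mul_mem (x 0).2 (x 1).2) (x 2).2,
      h.wedgeCoeff_eq_zero H (x 0).2 (mul_mem (x 1).2 (x 2).2), sub_zero, zero_add]

end IsCoreTrace

end Cocycle

/-! ## Multiplication by unbounded operators -/

section Core

variable {E : Type} [NormedAddCommGroup E] [InnerProductSpace ℂ E]

theorem zpowInv_unit {R : Type*} [Ring R] (u : Rˣ) (k : ℤ) :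
    zpowInv (u : R) k = ((u ^ k : Rˣ) : R) := by
  cases k with
  | ofNat n => simp [zpowInv]
  | negSucc n => simp [zpowInv, zpow_negSucc, ← inv_pow]

/-- The scalar is `p ^ k`, but for boundedness only its existence matters. -/
theorem zpow_mul_of_twisted {R : Type*} [Ring R] [Algebra ℂ R] {u : Rˣ} {x : R} {p : ℂ}
    (hp : p ≠ 0) (h : u * x = p • (x * u)) (k : ℤ) :
    ∃ c : ℂ, ((u ^ k : Rˣ) : R) * x = c • (x * ((u ^ k : Rˣ) : R)) := by
  have h' : ((u⁻¹ : Rˣ) : R) * x = p⁻¹ • (x * ((u⁻¹ : Rˣ) : R)) := by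
    rw [Units.inv_mul_eq_iff_eq_mul, mul_smul_comm, ← mul_assoc, h, smul_mul_assoc, mul_assoc,
      Units.mul_inv, mul_one, inv_smul_smul₀ hp]
  induction k with
  | zero => exact ⟨1, by simp⟩
  | succ k ih =>
    obtain ⟨c, hc⟩ := ih
    refine ⟨p * c, ?_⟩
    rw [zpow_add_one, Units.val_mul, mul_assoc, h, mul_smul_comm, ← mul_assoc, hc, smul_mul_assoc,
      smul_smul, mul_assoc]
  | pred k ih =>
    obtain ⟨c, hc⟩ := ih
    refine ⟨p⁻¹ * c, ?_⟩
    rw [zpow_sub_one, Units.val_mul, mul_assoc, h', mul_smul_comm, ← mul_assoc, hc,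
      smul_mul_assoc, smul_smul, mul_assoc]

/-- `‖Z t v‖² = ⟪t v, Z∗Z t v⟫`, and `Z∗Z t = c t + d Y t` is bounded even when `Z` is not. -/
theorem isBddOp_mul_of_star_mul {Z Y t : LPlus E} {c d : ℂ} (h : star Z * Z = c • 1 + d • Y)
    (ht : IsBddOp t) (hYt : IsBddOp (Y * t)) : IsBddOp (Z * t) := by
  obtain ⟨C, hC⟩ := (ht.smul c).add (hYt.smul d)
  obtain ⟨C', hC'⟩ := ht
  refine ⟨|C'| + |C|, fun v => ?_⟩
  have h1 : ‖(Z * t).1 v‖ ^ 2 ≤ ‖t.1 v‖ * ‖(c • t + d • (Y * t)).1 v‖ := by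
    have h2 : ⟪(Z * t).1 v, (Z * t).1 v⟫_ℂ = ⟪t.1 v, (c • t + d • (Y * t)).1 v⟫_ℂ := by
      have h3 : c • t + d • (Y * t) = star Z * Z * t := by
        rw [h, add_mul, smul_mul_assoc, smul_mul_assoc, one_mul]
      rw [h3]
      exact LPlus.inner_star Z (t.1 v) (Z.1 (t.1 v))
    have h4 : ‖⟪(Z * t).1 v, (Z * t).1 v⟫_ℂ‖ = ‖(Z * t).1 v‖ ^ 2 := by
      rw [inner_self_eq_norm_sq_to_K]; simp
    rw [← h4, h2]
    exact norm_inner_le_norm _ _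
  have h5 : ‖t.1 v‖ ≤ |C'| * ‖v‖ := (hC' v).trans (by gcongr; exact le_abs_self _)
  have h6 : ‖(c • t + d • (Y * t)).1 v‖ ≤ |C| * ‖v‖ :=
    (hC v).trans (by gcongr; exact le_abs_self _)
  refine le_of_sq_le_sq ?_ (by positivity)
  calc ‖(Z * t).1 v‖ ^ 2 ≤ (|C'| * ‖v‖) * (|C| * ‖v‖) :=
        h1.trans (mul_le_mul h5 h6 (norm_nonneg _) (by positivity))
    _ ≤ _ := by
        have : 0 ≤ |C'| * ‖v‖ := by positivity
        have : 0 ≤ |C| * ‖v‖ := by positivity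
        nlinarith

theorem bddCore_unit_mem_iff {u : (LPlus E)ˣ} {x : LPlus E} : x ∈ bddCore (u : LPlus E) ↔
    ∀ k l : ℤ, IsBddOp (((u ^ k : (LPlus E)ˣ) : LPlus E) * x * ((u ^ l : (LPlus E)ˣ) : LPlus E)) := by
  simp only [← zpowInv_unit]
  exact Iff.rfl

theorem zpow_mul_mem_bddCore {u : (LPlus E)ˣ} {x : LPlus E} (hx : x ∈ bddCore (u : LPlus E))
    (m n : ℤ) : ((u ^ m : (LPlus E)ˣ) : LPlus E) * x * ((u ^ n : (LPlus E)ˣ) : LPlus E) ∈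
      bddCore (u : LPlus E) := by
  rw [bddCore_unit_mem_iff] at hx ⊢
  intro k l
  have h := hx (k + m) (n + l)
  rw [zpow_add, zpow_add, Units.val_mul, Units.val_mul] at h
  simpa only [mul_assoc] using h

theorem isMulStable_unit (u : (LPlus E)ˣ) : IsMulStable (bddCore (u : LPlus E)) (u : LPlus E) where
  left s hs := by simpa using zpow_mul_mem_bddCore hs 1 0
  right s hs := by simpa using zpow_mul_mem_bddCore hs 0 1

theorem isMulStable_inv (u : (LPlus E)ˣ) :
    IsMulStable (bddCore (u : LPlus E)) ((u⁻¹ : (LPlus E)ˣ) : LPlus E) where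
  left s hs := by simpa using zpow_mul_mem_bddCore hs (-1) 0
  right s hs := by simpa using zpow_mul_mem_bddCore hs 0 (-1)

/-- Powers of `u` pass through `Z` up to scalars, so the claim reduces to boundedness of `Z (uᵏ x
uˡ)`; the extra factor `u` coming from `Z∗Z` only raises `k` by one. -/
theorem mul_mem_bddCore {u : (LPlus E)ˣ} {Z : LPlus E} {p c d : ℂ} (hp : p ≠ 0)
    (hZ : u * Z = p • (Z * u)) (h : star Z * Z = c • 1 + d • (u : LPlus E)) {x : LPlus E}
    (hx : x ∈ bddCore (u : LPlus E)) : Z * x ∈ bddCore (u : LPlus E) := by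
  rw [bddCore_unit_mem_iff]
  intro k l
  obtain ⟨c', hc'⟩ := zpow_mul_of_twisted hp hZ k
  rw [← mul_assoc, hc', smul_mul_assoc, smul_mul_assoc, mul_assoc, mul_assoc]
  refine IsBddOp.smul _ (isBddOp_mul_of_star_mul h ?_ ?_)
  · rw [← mul_assoc]
    exact bddCore_unit_mem_iff.1 hx k l
  · rw [← mul_assoc, ← mul_assoc, mul_assoc]
    have := bddCore_unit_mem_iff.1 hx (1 + k) l
    rw [zpow_add, zpow_one, Units.val_mul] at this
    simpa only [mul_assoc] using this

theorem isMulStable_of_star_mul {u : (LPlus E)ˣ} (hu : star (u : LPlus E) = u) {Z : LPlus E}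
    {p p' c d c' d' : ℂ} (hp : p ≠ 0) (hp' : p' ≠ 0) (hZ : u * Z = p • (Z * u))
    (hZ' : u * star Z = p' • (star Z * u)) (h : star Z * Z = c • 1 + d • (u : LPlus E))
    (h' : Z * star Z = c' • 1 + d' • (u : LPlus E)) :
    IsMulStable (bddCore (u : LPlus E)) Z where
  left _ hs := mul_mem_bddCore hp hZ h hs
  right s hs := by
    -- Right multiplication by `Z` is the adjoint of left multiplication by `Z∗`.
    have h1 := bddCore_star_mem _ hu
      (mul_mem_bddCore hp' hZ' (by rwa [star_star]) (bddCore_star_mem _ hu hs))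
    rwa [star_mul, star_star, star_star] at h1

end Core

/-! ## Traces -/

section Trace

theorem IsTraceClass.of_equiv {K κ : Type} [NormedAddCommGroup K] [InnerProductSpace ℂ K]
    (f : κ ≃ ℕ) {A : K →L[ℂ] K} (u v : κ → K) (h : Summable fun k => ‖u k‖ * ‖v k‖)
    (hA : ∀ x, HasSum (fun k => ⟪u k, x⟫_ℂ • v k) (A x)) : IsTraceClass A :=
  ⟨u ∘ f.symm, v ∘ f.symm, (f.symm.summable_iff (f := fun k => ‖u k‖ * ‖v k‖)).2 h,
    fun x => (f.symm.hasSum_iff (f := fun k => ⟪u k, x⟫_ℂ • v k)).2 (hA x)⟩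

/-- An operator on the span of an orthonormal family is of trace class if the norms of the images
of the basis vectors are summable. -/
theorem hasTraceClassClosure_of_summable {K κ : Type} [NormedAddCommGroup K]
    [InnerProductSpace ℂ K] [CompleteSpace K] (f : κ ≃ ℕ) {E : Submodule ℂ K} (b : κ → E)
    (hb : Orthonormal ℂ fun k => (b k : K)) (hspan : ⊤ ≤ Submodule.span ℂ (Set.range b))
    (T : Module.End ℂ E) (hT : Summable fun k => ‖T (b k)‖) : HasTraceClassClosure T := by
  have hn : ∀ k, ‖(b k : K)‖ = 1 := fun k => hb.1 k
  -- The rank one operators `⟪bₖ, ·⟫ T bₖ` have norm `‖T bₖ‖`, so their series converges in operator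
  -- norm and its sum is the continuous extension.
  have hs : Summable fun k => (innerSL ℂ (b k : K)).smulRight (T (b k) : K) := by
    refine Summable.of_norm ?_
    simpa [ContinuousLinearMap.norm_smulRight_apply, hn] using hT
  have hA : ∀ x, HasSum (fun k => ⟪(b k : K), x⟫_ℂ • (T (b k) : K))
      ((∑' k, (innerSL ℂ (b k : K)).smulRight (T (b k) : K)) x) := fun x => by
    simpa using (ContinuousLinearMap.apply ℂ K x).hasSum hs.hasSum
  refine ⟨_, fun v => ?_, IsTraceClass.of_equiv f (fun k => (b k : K)) (fun k => (T (b k) : K))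
    (by simpa [hn] using hT) hA⟩
  have hv : v ∈ Submodule.span ℂ (Set.range b) := hspan trivial
  induction hv using Submodule.span_induction with
  | mem x hx =>
    obtain ⟨j, rfl⟩ := hx
    refine (hA _).unique ?_
    classical
    have h1 : (fun k => ⟪(b k : K), (b j : K)⟫_ℂ • (T (b k) : K)) =
        fun k => if k = j then (T (b j) : K) else 0 := by
      funext k
      rw [orthonormal_iff_ite.1 hb k j]
      split_ifs with h
      · rw [h, one_smul]
      · rw [zero_smul]
    rw [h1]
    exact hasSum_ite_eq j _
  | zero => simp
  | add x y _ _ hx hy => simp only [Submodule.coe_add, map_add, hx, hy]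
  | smul c x _ hx => simp only [Submodule.coe_smul, map_smul, hx]

variable {ι K : Type} [NormedAddCommGroup K] [InnerProductSpace ℂ K] {e : HilbertBasis ι ℂ K}

theorem domBasis_norm (n : ι) : ‖domBasis e n‖ = 1 := by
  rw [Submodule.coe_norm, domBasis_coe]
  exact e.orthonormal.1 n

theorem domBasis_orthonormal : Orthonormal ℂ fun n => (domBasis e n : K) := by
  simpa only [domBasis_coe] using e.orthonormal

/-- The norms of the images of the basis vectors are dominated by `r`. -/
def IsDominated (e : HilbertBasis ι ℂ K) (r : ι → ℝ) (T : LPlus (Dom e)) : Prop :=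
  ∃ C : ℝ, ∀ n, ‖T.1 (domBasis e n)‖ ≤ C * r n

variable {r : ι → ℝ}

theorem IsDominated.summable (hr : Summable r) {T : LPlus (Dom e)} (hT : IsDominated e r T) :
    Summable fun n => ‖T.1 (domBasis e n)‖ := by
  obtain ⟨C, hC⟩ := hT
  exact Summable.of_nonneg_of_le (fun _ => norm_nonneg _) hC (hr.mul_left C)

theorem IsDominated.summable_inner (hr : Summable r) {T : LPlus (Dom e)}
    (hT : IsDominated e r T) : Summable fun n => ⟪domBasis e n, T.1 (domBasis e n)⟫_ℂ := by
  refine Summable.of_norm_bounded (hT.summable hr) fun n => ?_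
  exact (norm_inner_le_norm _ _).trans_eq (by rw [domBasis_norm, one_mul])

/-- Parseval turns both traces into double sums of products of matrix entries. These are dominated
by `‖S eₘ‖ ‖T eₙ‖`, so the order of summation may be exchanged. -/
theorem opTrace_mul_comm (hr : Summable r) {S T : LPlus (Dom e)} (hS : IsDominated e r S)
    (hT : IsDominated e r T) :
    opTrace (domBasis e) (S * T).1 = opTrace (domBasis e) (T * S).1 := by
  have key : ∀ (S T : LPlus (Dom e)) (n : ι), ⟪domBasis e n, (S * T).1 (domBasis e n)⟫_ℂ =
      ∑' m, ⟪domBasis e n, S.1 (domBasis e m)⟫_ℂ * ⟪domBasis e m, T.1 (domBasis e n)⟫_ℂ := by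
    intro S T n
    have h1 : ⟪domBasis e n, (S * T).1 (domBasis e n)⟫_ℂ =
        ⟪(star S).1 (domBasis e n), T.1 (domBasis e n)⟫_ℂ :=
      (LPlus.adjoint_symm (LPlus.inner_star S) _ _).symm
    rw [h1, Submodule.coe_inner, ← e.tsum_inner_mul_inner]
    refine tsum_congr fun m => ?_
    rw [← domBasis_coe, ← Submodule.coe_inner, ← Submodule.coe_inner,
      LPlus.adjoint_symm (LPlus.inner_star S)]
  have hle : ∀ (T : LPlus (Dom e)) (m n : ι),
      ‖⟪domBasis e m, T.1 (domBasis e n)⟫_ℂ‖ ≤ ‖T.1 (domBasis e n)‖ := fun T m n =>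
    (norm_inner_le_norm _ _).trans_eq (by rw [domBasis_norm, one_mul])
  rw [opTrace, opTrace]
  simp only [key]
  rw [Summable.tsum_comm]
  · exact tsum_congr fun m => tsum_congr fun n => mul_comm _ _
  · have h2 := (hS.summable hr).mul_of_nonneg (hT.summable hr) (fun _ => norm_nonneg _)
      (fun _ => norm_nonneg _)
    refine Summable.of_norm_bounded h2 fun i => ?_
    rw [Function.uncurry, norm_mul]
    exact mul_le_mul (hle S _ _) (hle T _ _) (norm_nonneg _) (norm_nonneg _)

theorem IsDominated.hasTraceClassClosure [CompleteSpace K] (f : ι ≃ ℕ) (hr : Summable r)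
    {T : LPlus (Dom e)} (hT : IsDominated e r T) : HasTraceClassClosure T.1 :=
  hasTraceClassClosure_of_summable f (domBasis e) domBasis_orthonormal (domBasis e).span_eq.ge _
    (hT.summable hr)

theorem dom₂Basis_orthonormal : Orthonormal ℂ fun k => (dom₂Basis e k : PiLp 2 fun _ : Fin 2 => K) := by
  classical
  rw [orthonormal_iff_ite]
  rintro ⟨i, m⟩ ⟨j, n⟩
  have h := orthonormal_iff_ite.1 e.orthonormal m n
  fin_cases i <;> fin_cases j <;> simp [dom₂Basis, PiLp.inner_apply, domBasis_coe, h]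

theorem dom₂Basis_span : ⊤ ≤ Submodule.span ℂ (Set.range (dom₂Basis e)) := by
  rintro w -
  have h : ∀ (i : Fin 2) (v : Dom e), (⟨WithLp.toLp 2 (Pi.single i (v : K)), fun j => by
      by_cases h : j = i
      · subst h; simp
      · simp [h]⟩ : Dom₂ e) ∈ Submodule.span ℂ (Set.range (dom₂Basis e)) := by
    intro i v
    have hv := (domBasis e).mem_span v
    induction hv using Submodule.span_induction with
    | mem x hx =>
      obtain ⟨n, rfl⟩ := hx
      exact Submodule.subset_span ⟨(i, n), rfl⟩
    | zero =>
      convert Submodule.zero_mem _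
      ext j
      simp
    | add x y _ _ hx hy =>
      convert add_mem hx hy
      ext j
      simp [Pi.single_apply]; split_ifs <;> simp
    | smul c x _ hx =>
      convert Submodule.smul_mem _ c hx
      ext j
      simp [Pi.single_apply]
  convert add_mem (h 0 ⟨w.1 0, w.2 0⟩) (h 1 ⟨w.1 1, w.2 1⟩)
  ext j
  fin_cases j <;> simp

theorem matrixOp_dom₂Basis (M : Matrix (Fin 2) (Fin 2) (LPlus (Dom e))) (k : Fin 2 × ι)
    (i : Fin 2) : (matrixOp M (dom₂Basis e k)).1 i = ((M i k.1).1 (domBasis e k.2) : K) := by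
  obtain ⟨j, n⟩ := k
  change ((∑ j', (M i j').1 ⟨(dom₂Basis e (j, n)).1 j', (dom₂Basis e (j, n)).2 j'⟩ : Dom e) : K) = _
  congr 1
  rw [Finset.sum_eq_single j]
  · congr 1
    exact Subtype.ext (by simp [dom₂Basis])
  · intro j' _ hj
    have h0 : (⟨(dom₂Basis e (j, n)).1 j', (dom₂Basis e (j, n)).2 j'⟩ : Dom e) = 0 :=
      Subtype.ext (by simp [dom₂Basis, hj])
    rw [h0, map_zero]
  · simp

theorem matrixOp_summable (hr : Summable r) {M : Matrix (Fin 2) (Fin 2) (LPlus (Dom e))}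
    (hM : ∀ i j, IsDominated e r (M i j)) :
    Summable fun k => ‖matrixOp M (dom₂Basis e k)‖ := by
  have h : ∀ k, ‖matrixOp M (dom₂Basis e k)‖ ≤
      ‖(M 0 k.1).1 (domBasis e k.2)‖ + ‖(M 1 k.1).1 (domBasis e k.2)‖ := by
    intro k
    rw [Submodule.coe_norm, PiLp.norm_eq_of_L2, Fin.sum_univ_two, matrixOp_dom₂Basis,
      matrixOp_dom₂Basis, Real.sqrt_le_left (by positivity)]
    have h0 := norm_nonneg ((M 0 k.1).1 (domBasis e k.2))
    have h1 := norm_nonneg ((M 1 k.1).1 (domBasis e k.2))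
    simp only [Submodule.coe_norm] at *
    nlinarith
  refine Summable.of_nonneg_of_le (fun _ => norm_nonneg _) h ?_
  have hsum : ∀ i, Summable fun k : Fin 2 × ι => ‖(M i k.1).1 (domBasis e k.2)‖ := fun i => by
    rw [summable_prod_of_nonneg (fun _ => norm_nonneg _)]
    exact ⟨fun j => (hM i j).summable hr, Summable.of_finite⟩
  exact (hsum 0).add (hsum 1)

theorem hasTraceClassClosure_matrixOp [CompleteSpace K] (f : ι ≃ ℕ) (hr : Summable r)
    {M : Matrix (Fin 2) (Fin 2) (LPlus (Dom e))} (hM : ∀ i j, IsDominated e r (M i j)) :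
    HasTraceClassClosure (matrixOp M) := by
  -- Trace class operators are defined by sequences, so the basis of the direct sum is reindexed by
  -- `ℕ`.
  have g : Fin 2 × ι ≃ ℕ := by
    haveI := Denumerable.ofEquiv ℕ f
    haveI : Infinite (Fin 2 × ι) := inferInstance
    haveI := Encodable.ofCountable (Fin 2 × ι)
    haveI := Denumerable.ofEncodableOfInfinite (Fin 2 × ι)
    exact Denumerable.eqv _
  exact hasTraceClassClosure_of_summable g (dom₂Basis e) dom₂Basis_orthonormal dom₂Basis_span
    (matrixOp M) (matrixOp_summable hr hM)

theorem opTrace_matrixOp (hr : Summable r) {M : Matrix (Fin 2) (Fin 2) (LPlus (Dom e))}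
    (hM : ∀ i j, IsDominated e r (M i j)) : opTrace (dom₂Basis e) (matrixOp M) =
      opTrace (domBasis e) (M 0 0).1 + opTrace (domBasis e) (M 1 1).1 := by
  have h : ∀ k, ⟪dom₂Basis e k, matrixOp M (dom₂Basis e k)⟫_ℂ =
      ⟪domBasis e k.2, (M k.1 k.1).1 (domBasis e k.2)⟫_ℂ := by
    rintro ⟨i, n⟩
    rw [Submodule.coe_inner, PiLp.inner_apply, Finset.sum_eq_single i]
    · rw [matrixOp_dom₂Basis]
      simp [dom₂Basis, Submodule.coe_inner]
    · intro j _ hj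
      simp [dom₂Basis, hj]
    · simp
  have hs : Summable fun k => ⟪dom₂Basis e k, matrixOp M (dom₂Basis e k)⟫_ℂ := by
    refine Summable.of_norm_bounded (matrixOp_summable hr hM) fun k => ?_
    have h1 : ‖(dom₂Basis e k : PiLp 2 fun _ : Fin 2 => K)‖ = 1 := dom₂Basis_orthonormal.1 k
    exact (norm_inner_le_norm (𝕜 := ℂ) (dom₂Basis e k) (matrixOp M (dom₂Basis e k))).trans_eq
      (by rw [Submodule.coe_norm, h1, one_mul])
  simp only [h] at hs
  simp only [opTrace, h]
  rw [hs.tsum_prod' fun i => (hM i i).summable_inner hr, tsum_fintype, Fin.sum_univ_two]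

end Trace

/-! ### The trace on the core of a diagonal operator -/

section Trace

variable {ι K : Type} [NormedAddCommGroup K] [InnerProductSpace ℂ K] {e : HilbertBasis ι ℂ K}

/-- The trace on a subalgebra of dominated operators extends to a linear functional. -/
theorem exists_linearMap_eq_opTrace {r : ι → ℝ} (hr : Summable r)
    (S : NonUnitalSubalgebra ℂ (LPlus (Dom e))) (hS : ∀ x ∈ S, IsDominated e r x) :
    ∃ T : LPlus (Dom e) →ₗ[ℂ] ℂ, ∀ x ∈ S, T x = opTrace (domBasis e) x.1 := by
  have hs : ∀ x ∈ S, Summable fun n => ⟪domBasis e n, x.1 (domBasis e n)⟫_ℂ :=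
    fun x hx => (hS x hx).summable_inner hr
  -- The sum is known to be additive only under summability; an arbitrary linear extension from `S`
  -- makes linearity available without side conditions.
  let T₀ : S.toSubmodule →ₗ[ℂ] ℂ :=
    { toFun := fun x => opTrace (domBasis e) x.1.1
      map_add' := fun x y => (tsum_congr fun n => inner_add_right _ _ _).trans
        ((hs x.1 x.2).tsum_add (hs y.1 y.2))
      map_smul' := fun c x => (tsum_congr fun n => inner_smul_right _ _ _).trans
        (tsum_mul_left (a := c) (f := fun n => ⟪domBasis e n, x.1.1 (domBasis e n)⟫_ℂ)) }
  obtain ⟨T, hT⟩ := LinearMap.exists_extend T₀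
  exact ⟨T, fun x hx => LinearMap.congr_fun hT ⟨x, hx⟩⟩

/-- Only boundedness of `x u` and `x u⁻¹` is needed: on the eigenvector `eₙ` it bounds `λₙ ‖x eₙ‖`
and `λₙ⁻¹ ‖x eₙ‖`. -/
theorem isDominated_of_mem_bddCore {u : (LPlus (Dom e))ˣ} {lam : ι → ℝ} (hpos : ∀ n, 0 < lam n)
    (hu : ∀ n, (u : LPlus (Dom e)).1 (domBasis e n) = (lam n : ℂ) • domBasis e n)
    {x : LPlus (Dom e)} (hx : x ∈ bddCore (u : LPlus (Dom e))) :
    IsDominated e (fun n => min (lam n) (lam n)⁻¹) x := by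
  rw [bddCore_unit_mem_iff] at hx
  have hu' : ∀ n, ((u⁻¹ : (LPlus (Dom e))ˣ) : LPlus (Dom e)).1 (domBasis e n) =
      (((lam n)⁻¹ : ℝ) : ℂ) • domBasis e n := fun n => by
    have h1 : ((u⁻¹ : (LPlus (Dom e))ˣ) : LPlus (Dom e)).1
        ((u : LPlus (Dom e)).1 (domBasis e n)) = domBasis e n :=
      LinearMap.congr_fun (congrArg Subtype.val u.inv_mul) (domBasis e n)
    have h2 : (lam n : ℂ) ≠ 0 := by exact_mod_cast (hpos n).ne'
    rw [hu, map_smul] at h1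
    rw [Complex.ofReal_inv, eq_inv_smul_iff₀ h2, h1]
  obtain ⟨C, hC⟩ := hx 0 1
  obtain ⟨C', hC'⟩ := hx 0 (-1)
  refine ⟨max C C', fun n => ?_⟩
  have hl := hpos n
  have h1 : lam n * ‖x.1 (domBasis e n)‖ ≤ C := by
    have h := hC (domBasis e n)
    rw [domBasis_norm n, mul_one, zpow_zero, Units.val_one, one_mul, zpow_one] at h
    change ‖x.1 ((u : LPlus (Dom e)).1 _)‖ ≤ C at h
    rwa [hu, map_smul, norm_smul, Complex.norm_real, Real.norm_of_nonneg hl.le] at h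
  have h2 : (lam n)⁻¹ * ‖x.1 (domBasis e n)‖ ≤ C' := by
    have h := hC' (domBasis e n)
    rw [domBasis_norm n, mul_one, zpow_zero, Units.val_one, one_mul, zpow_neg_one] at h
    change ‖x.1 (((u⁻¹ : (LPlus (Dom e))ˣ) : LPlus (Dom e)).1 _)‖ ≤ C' at h
    rwa [hu', map_smul, norm_smul, Complex.norm_real,
      Real.norm_of_nonneg (inv_nonneg.2 hl.le)] at h
  rw [inv_mul_le_iff₀ hl, mul_comm] at h2
  rw [mul_comm, ← le_div_iff₀ hl, div_eq_mul_inv] at h1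
  rcases min_choice (lam n) (lam n)⁻¹ with h | h <;> simp only [h]
  · exact h2.trans (mul_le_mul_of_nonneg_right (le_max_right _ _) hl.le)
  · exact h1.trans (mul_le_mul_of_nonneg_right (le_max_left _ _) (inv_nonneg.2 hl.le))

end Trace

/-! ### Stability of the core under the generators -/

section Core

variable {E : Type} [NormedAddCommGroup E] [InnerProductSpace ℂ E]

theorem isMulStable_of_isQuantumPlane {u : (LPlus E)ˣ} (hu : star (u : LPlus E) = u)
    {p a b : ℂ} {z yi : LPlus E} (H : IsQuantumPlane p a b z (star z) u yi) :
    IsMulStable (bddCore (u : LPlus E)) z ∧ IsMulStable (bddCore (u : LPlus E)) (star z) := by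
  have hp := H.ne_zero
  have h1 : star z * z = a • 1 + (-(p * b)) • (u : LPlus E) := by
    rw [H.wz, Algebra.algebraMap_eq_smul_one, sub_eq_add_neg, ← neg_smul]
  have h2 : z * star z = a • 1 + (-b) • (u : LPlus E) := by
    rw [H.zw, Algebra.algebraMap_eq_smul_one, sub_eq_add_neg, ← neg_smul]
  exact ⟨isMulStable_of_star_mul hu hp (inv_ne_zero hp) H.y_z H.y_w h1 h2,
    isMulStable_of_star_mul hu (inv_ne_zero hp) hp H.y_w (by rw [star_star]; exact H.y_z)
      (by rw [star_star]; exact h2) (by rw [star_star]; exact h1)⟩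

end Core

/-! ### The commutator formula and the representation of the coordinate algebra -/

section Commutator

variable {A : Type} [Ring A] [Algebra ℂ A]

theorem grading_mul_commutator_mul_commutator (p : ℂ) (z w yi x₀ x₁ x₂ : A) :
    !![algebraMap ℂ A p, 0; 0, -1] * diagHom A yi * diagHom A x₀ *
      (offDiag p z w * diagHom A x₁ - diagHom A x₁ * offDiag p z w) *
      (offDiag p z w * diagHom A x₂ - diagHom A x₂ * offDiag p z w) =
    !![((1 - p)⁻¹ ^ 2 * p) • (yi * (x₀ * ((z * x₁ - x₁ * z) * (w * x₂ - x₂ * w)))), 0;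
      0, (-((1 - p)⁻¹ ^ 2)) • (yi * (x₀ * ((w * x₁ - x₁ * w) * (z * x₂ - x₂ * z))))] := by
  have h : ∀ x, offDiag p z w * diagHom A x - diagHom A x * offDiag p z w = (1 - p)⁻¹ •
      !![0, z * x - x * z; w * x - x * w, 0] := fun x => by
    rw [diagHom_apply]
    ext i j
    fin_cases i <;> fin_cases j <;> simp [smul_sub]
  have hg : ∀ r : A, !![algebraMap ℂ A p, 0; 0, -1] * diagHom A yi * diagHom A r =
      !![p • (yi * r), 0; 0, -(yi * r)] := fun r => by
    rw [diagHom_apply, diagHom_apply]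
    simp [Algebra.algebraMap_eq_smul_one]
  rw [hg, h, h, Matrix.mul_smul, Matrix.mul_smul, Matrix.smul_mul]
  simp [smul_smul, mul_assoc, pow_two]

/-- The sum of the two diagonal blocks: the weights `p` and `-1` of the grading are, up to a common
sign, the weights of the two terms of `wedgeCoeff`. -/
theorem trace_part_commutator (p : ℂ) (z w yi x₀ x₁ x₂ : A) :
    ((1 - p)⁻¹ ^ 2 * p) • (yi * (x₀ * ((z * x₁ - x₁ * z) * (w * x₂ - x₂ * w)))) +
      (-((1 - p)⁻¹ ^ 2)) • (yi * (x₀ * ((w * x₁ - x₁ * w) * (z * x₂ - x₂ * z)))) =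
    -(yi * (x₀ * wedgeCoeff p z w x₁ x₂)) := by
  simp only [wedgeCoeff, mul_smul_comm, mul_sub yi, mul_sub x₀, smul_sub, smul_smul]
  module

theorem exists_hom_of_relation {q : ℝ} {α : SignType} {z w : A}
    (h : w * z - (q : ℂ) ^ 2 • (z * w) =
      algebraMap ℂ A (SignType.cast α * (1 - (q : ℂ) ^ 2))) :
    ∃ φ : X₀ q α →ₐ[ℂ] A, φ (X₀.gen q α 0) = z ∧ φ (X₀.gen q α 1) = w := by
  refine ⟨RingQuot.liftAlgHom ℂ ⟨FreeAlgebra.lift ℂ ![z, w], ?_⟩, ?_, ?_⟩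
  · rintro _ _ ⟨⟩
    rw [map_sub, map_mul, map_smul, map_mul, AlgHom.commutes, FreeAlgebra.lift_ι_apply,
      FreeAlgebra.lift_ι_apply]
    exact h
  · rw [X₀.gen, RingQuot.liftAlgHom_mkAlgHom_apply, FreeAlgebra.lift_ι_apply]
    rfl
  · rw [X₀.gen, RingQuot.liftAlgHom_mkAlgHom_apply, FreeAlgebra.lift_ι_apply]
    rfl

end Commutator

/-! ### The three concrete representations -/

section Quantum

/-- The eigenvalues of the operator `y`. -/
def yEigenvalue (q : ℝ) : (α : SignType) → Idx α → ℝ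
  | .zero => fun n => q ^ (2 * n)
  | .neg => fun n => (q ^ (2 * (n + 1)))⁻¹
  | .pos => fun n => q ^ (2 * n)

theorem yEigenvalue_pos {q : ℝ} (hq : 0 < q) (α : SignType) (n : Idx α) :
    0 < yEigenvalue q α n := by
  cases α <;> simp only [yEigenvalue] <;> positivity

/-- The eigenvalues tend to `0` geometrically for `α = 1`, to infinity for `α = -1`, and do both, at
the two ends of `ℤ`, for `α = 0`; the minimum with the inverse decays in every case. -/
theorem summable_yEigenvalue {q : ℝ} (hq : 0 < q) (hq1 : q < 1) (α : SignType) :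
    Summable fun n => min (yEigenvalue q α n) (yEigenvalue q α n)⁻¹ := by
  have hg : Summable fun n : ℕ => q ^ (2 * n) := by
    simp only [pow_mul]
    exact summable_geometric_of_lt_one (by positivity) (by nlinarith)
  have h0 : ∀ n, 0 ≤ min (yEigenvalue q α n) (yEigenvalue q α n)⁻¹ := fun n =>
    le_min (yEigenvalue_pos hq α n).le (inv_nonneg.2 (yEigenvalue_pos hq α n).le)
  cases α with
  | zero =>
    refine Summable.of_nat_of_neg ?_ ?_
    · refine Summable.of_nonneg_of_le (fun n => h0 _) (fun n => min_le_left _ _) ?_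
      exact_mod_cast hg
    · refine Summable.of_nonneg_of_le (fun n => h0 _) (fun n => min_le_right _ _) ?_
      refine hg.congr fun n => ?_
      simp only [yEigenvalue]
      rw [← zpow_neg, mul_neg, neg_neg]
      norm_cast
  | neg =>
    refine Summable.of_nonneg_of_le h0 (fun n => min_le_right _ _) ?_
    simp only [yEigenvalue, inv_inv]
    exact (summable_nat_add_iff 1).2 hg
  | pos => exact Summable.of_nonneg_of_le h0 (fun n => min_le_left _ _) hg

theorem coe_sqrt_smul_smul {V : Type*} [AddCommGroup V] [Module ℂ V] {x c : ℝ} (hx : 0 ≤ x)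
    (h : x = c) (v : V) : (√x : ℂ) • (√x : ℂ) • v = (c : ℂ) • v := by
  rw [smul_smul, ← Complex.ofReal_mul, Real.mul_self_sqrt hx, h]

theorem z_mul_star_apply {q : ℝ} (hq : 0 < q) (hq1 : q < 1) (α : SignType) (n : Idx α) :
    (zX q α * star (zX q α)).1 (domBasis (eBasis α) n) =
      (((SignType.cast α : ℝ) - betaSign α * yEigenvalue q α n : ℝ) : ℂ) •
        domBasis (eBasis α) n := by
  change zOp q α ((star (zX q α)).1 (domBasis (eBasis α) n)) = _
  rw [zX_star]
  have hpow : ∀ k : ℕ, q ^ k ≤ 1 := fun k => pow_le_one₀ hq.le hq1.le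
  cases α with
  | zero =>
    simp only [zOp, zsOp, eBasis, weightedShift_apply, map_smul, smul_smul, sub_add_cancel,
      betaSign, yEigenvalue, SignType.cast]
    congr 1
    rw [← Complex.ofReal_mul, ← zpow_add₀ hq.ne', two_mul]
    simp
  | neg =>
    simp only [zOp, zsOp, eBasis, weightedShift_apply, map_smul, add_tsub_cancel_right,
      betaSign, yEigenvalue, SignType.cast]
    refine coe_sqrt_smul_smul ?_ (by ring) _
    rw [sub_nonneg]
    exact (one_le_inv₀ (by positivity)).2 (hpow _)
  | pos =>
    simp only [zOp, zsOp, eBasis, weightedShift_apply, map_smul, betaSign, yEigenvalue,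
      SignType.cast]
    -- At `n = 0` the truncated subtraction `n - 1` is harmless because the weight of `z∗` is `√(1 -
    -- 1) = 0`.
    cases n with
    | zero => simp
    | succ n =>
      exact coe_sqrt_smul_smul (sub_nonneg.2 (hpow _)) (by ring) _

theorem star_z_mul_apply {q : ℝ} (hq : 0 < q) (hq1 : q < 1) (α : SignType) (n : Idx α) :
    (star (zX q α) * zX q α).1 (domBasis (eBasis α) n) =
      (((SignType.cast α : ℝ) - q ^ 2 * betaSign α * yEigenvalue q α n : ℝ) : ℂ) •
        domBasis (eBasis α) n := by
  change (star (zX q α)).1 (zOp q α (domBasis (eBasis α) n)) = _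
  rw [zX_star]
  have hpow : ∀ k : ℕ, q ^ k ≤ 1 := fun k => pow_le_one₀ hq.le hq1.le
  cases α with
  | zero =>
    simp only [zOp, zsOp, eBasis, weightedShift_apply, map_smul, smul_smul, add_sub_cancel_right,
      betaSign, yEigenvalue, SignType.cast]
    congr 1
    rw [← Complex.ofReal_mul, ← zpow_add₀ hq.ne']
    have h2 : (n + 1) + (n + 1) = 2 * n + 2 := by ring
    have h3 : q ^ (2 : ℤ) = q ^ 2 := by norm_cast
    rw [h2, zpow_add₀ hq.ne', h3]
    congr 1
    ring
  | neg =>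
    simp only [zOp, zsOp, eBasis, weightedShift_apply, map_smul, betaSign, yEigenvalue,
      SignType.cast]
    -- Here `z` is the lowering operator, and its weight at `n = 0` is `√(1 - 1) = 0`.
    cases n with
    | zero => simp [hq.ne']
    | succ n =>
      refine coe_sqrt_smul_smul ?_ ?_ _
      · rw [sub_nonneg]
        exact (one_le_inv₀ (by positivity)).2 (hpow _)
      · have := hq.ne'
        field_simp
        ring
  | pos =>
    simp only [zOp, zsOp, eBasis, weightedShift_apply, map_smul, add_tsub_cancel_right,
      betaSign, yEigenvalue, SignType.cast]
    exact coe_sqrt_smul_smul (sub_nonneg.2 (hpow _)) (by ring) _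

theorem betaSign_mul_self (α : SignType) : betaSign α * betaSign α = 1 := by
  cases α <;> norm_num [betaSign]

theorem cast_eq_ofReal (α : SignType) :
    (SignType.cast α : ℂ) = ((SignType.cast α : ℝ) : ℂ) := by
  cases α <;> simp [SignType.cast]

theorem yX_apply {q : ℝ} (hq : 0 < q) (hq1 : q < 1) (α : SignType) (n : Idx α) :
    (yX q α).1 (domBasis (eBasis α) n) =
      (yEigenvalue q α n : ℂ) • domBasis (eBasis α) n := by
  have h := z_mul_star_apply hq hq1 α n
  have hb : (betaSign α : ℂ) * betaSign α = 1 := by exact_mod_cast betaSign_mul_self α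
  change (betaSign α : ℂ) • ((SignType.cast α : ℂ) • domBasis (eBasis α) n -
    (zX q α * star (zX q α)).1 (domBasis (eBasis α) n)) = _
  rw [h, cast_eq_ofReal, ← sub_smul, smul_smul]
  congr 1
  push_cast
  linear_combination (yEigenvalue q α n : ℂ) * hb

theorem LPlus.ext_domBasis {α : SignType} {S T : XAlg α}
    (h : ∀ n, S.1 (domBasis (eBasis α) n) = T.1 (domBasis (eBasis α) n)) : S = T :=
  Subtype.ext ((domBasis (eBasis α)).ext h)

/-- The inverse of `y` as a diagonal operator. -/
def yInvDiag (q : ℝ) (α : SignType) : XAlg α :=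
  ⟨weightedShift (eBasis α) (fun n => (yEigenvalue q α n)⁻¹) id,
    weightedShift (eBasis α) (fun n => (yEigenvalue q α n)⁻¹) id,
    weightedShift_adjoint _ _ _ _ _ (fun _ _ => ⟨rfl, rfl⟩) (fun _ _ => ⟨rfl, rfl⟩)⟩

theorem yInvDiag_apply (q : ℝ) (α : SignType) (n : Idx α) :
    (yInvDiag q α).1 (domBasis (eBasis α) n) =
      (((yEigenvalue q α n)⁻¹ : ℝ) : ℂ) • domBasis (eBasis α) n :=
  weightedShift_apply _ _ _ _

theorem yX_mul_yInvDiag {q : ℝ} (hq : 0 < q) (hq1 : q < 1) (α : SignType) :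
    yX q α * yInvDiag q α = 1 :=
  LPlus.ext_domBasis fun n => by
    have h := (yEigenvalue_pos hq α n).ne'
    change (yX q α).1 ((yInvDiag q α).1 _) = domBasis (eBasis α) n
    rw [yInvDiag_apply, map_smul, yX_apply hq hq1, smul_smul,
      ← Complex.ofReal_mul, inv_mul_cancel₀ h, Complex.ofReal_one, one_smul]

theorem yInvDiag_mul_yX {q : ℝ} (hq : 0 < q) (hq1 : q < 1) (α : SignType) :
    yInvDiag q α * yX q α = 1 :=
  LPlus.ext_domBasis fun n => by
    have h := (yEigenvalue_pos hq α n).ne'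
    change (yInvDiag q α).1 ((yX q α).1 _) = domBasis (eBasis α) n
    rw [yX_apply hq hq1, map_smul, yInvDiag_apply, smul_smul,
      ← Complex.ofReal_mul, mul_inv_cancel₀ h, Complex.ofReal_one, one_smul]

theorem exists_yUnit {q : ℝ} (hq : 0 < q) (hq1 : q < 1) (α : SignType) :
    ∃ u : (XAlg α)ˣ, (u : XAlg α) = yX q α ∧ ((u⁻¹ : (XAlg α)ˣ) : XAlg α) = yInvDiag q α :=
  ⟨⟨yX q α, yInvDiag q α, yX_mul_yInvDiag hq hq1 α, yInvDiag_mul_yX hq hq1 α⟩, rfl, rfl⟩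

theorem yInv_eq {q : ℝ} (hq : 0 < q) (hq1 : q < 1) (α : SignType) :
    yInv q α = yInvDiag q α := by
  obtain ⟨u, hu, hu'⟩ := exists_yUnit hq hq1 α
  rw [yInv, ← hu, ← hu', Ring.inverse_unit]

theorem z_rel {q : ℝ} (hq : 0 < q) (hq1 : q < 1) (α : SignType) :
    star (zX q α) * zX q α - (q : ℂ) ^ 2 • (zX q α * star (zX q α)) =
      algebraMap ℂ (XAlg α) (SignType.cast α * (1 - (q : ℂ) ^ 2)) :=
  LPlus.ext_domBasis fun n => by
    change (star (zX q α) * zX q α).1 (domBasis (eBasis α) n) -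
      (q : ℂ) ^ 2 • (zX q α * star (zX q α)).1 (domBasis (eBasis α) n) =
        (SignType.cast α * (1 - (q : ℂ) ^ 2)) • domBasis (eBasis α) n
    rw [z_mul_star_apply hq hq1, star_z_mul_apply hq hq1, cast_eq_ofReal, smul_smul, ← sub_smul]
    congr 1
    push_cast
    ring

theorem isQuantumPlane {q : ℝ} (hq : 0 < q) (hq1 : q < 1) (α : SignType) :
    IsQuantumPlane ((q : ℂ) ^ 2) (SignType.cast α) (betaSign α) (zX q α) (star (zX q α))
      (yX q α) (yInv q α) where
  ne_zero := pow_ne_zero 2 (by exact_mod_cast hq.ne')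
  ne_one := by
    have : 1 - q ^ 2 ≠ 0 := by nlinarith
    exact_mod_cast this
  ne_neg_one := by
    have : 1 + q ^ 2 ≠ 0 := by positivity
    exact_mod_cast this
  sq := by exact_mod_cast betaSign_mul_self α
  rel := z_rel hq hq1 α
  y_eq := rfl
  mul_inv := by rw [yInv_eq hq hq1]; exact yX_mul_yInvDiag hq hq1 α
  inv_mul := by rw [yInv_eq hq hq1]; exact yInvDiag_mul_yX hq hq1 α

variable {q : ℝ} (hq : 0 < q) (hq1 : q < 1) (α : SignType)
include hq hq1

theorem isMulStable_y : IsMulStable (Xc q α) (yX q α) := by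
  obtain ⟨u, hu, -⟩ := exists_yUnit hq hq1 α
  rw [Xc, ← hu]
  exact isMulStable_unit u

theorem isMulStable_yInv : IsMulStable (Xc q α) (yInv q α) := by
  obtain ⟨u, hu, hu'⟩ := exists_yUnit hq hq1 α
  rw [yInv_eq hq hq1, Xc, ← hu, ← hu']
  exact isMulStable_inv u

theorem isMulStable_z_and_star :
    IsMulStable (Xc q α) (zX q α) ∧ IsMulStable (Xc q α) (star (zX q α)) := by
  have H := isQuantumPlane hq hq1 α
  have hy := yX_star q α
  obtain ⟨u, hu, -⟩ := exists_yUnit hq hq1 α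
  rw [Xc]
  rw [← hu] at H hy ⊢
  exact isMulStable_of_isQuantumPlane hy H

theorem isDominated_of_mem {x : XAlg α} (hx : x ∈ Xc q α) :
    IsDominated (eBasis α) (fun n => min (yEigenvalue q α n) (yEigenvalue q α n)⁻¹) x := by
  obtain ⟨u, hu, -⟩ := exists_yUnit hq hq1 α
  rw [Xc, ← hu] at hx
  exact isDominated_of_mem_bddCore (yEigenvalue_pos hq α)
    (fun n => by rw [hu]; exact yX_apply hq hq1 α n) hx

/-- A linear functional on `X` which is the trace on `X_c`. -/
theorem exists_isCoreTrace : ∃ T : XAlg α →ₗ[ℂ] ℂ,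
    (∀ x ∈ Xc q α, T x = opTrace (domBasis (eBasis α)) x.1) ∧
      IsCoreTrace (Xc q α) T (zX q α) (star (zX q α)) (yX q α) (yInv q α) := by
  have hr := summable_yEigenvalue hq hq1 α
  obtain ⟨T, hT'⟩ := exists_linearMap_eq_opTrace hr (Xc q α) fun x hx =>
    isDominated_of_mem hq hq1 α hx
  obtain ⟨h1, h2⟩ := isMulStable_z_and_star hq hq1 α
  refine ⟨T, hT', h1, h2, isMulStable_y hq hq1 α, isMulStable_yInv hq hq1 α, fun r hrm s hsm => ?_⟩
  rw [hT' _ (mul_mem hrm hsm), hT' _ (mul_mem hsm hrm)]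
  exact opTrace_mul_comm hr (isDominated_of_mem hq hq1 α hrm) (isDominated_of_mem hq hq1 α hsm)

omit hq hq1 in
theorem nonempty_idx_equiv : Nonempty (Idx α ≃ ℕ) := by
  cases α
  · exact ⟨Equiv.intEquivNat⟩
  · exact ⟨Equiv.refl ℕ⟩
  · exact ⟨Equiv.refl ℕ⟩

omit hq hq1 in
theorem commOp_eq (x₀ x₁ x₂ : XAlg α) : commOp q α x₀ x₁ x₂ =
    !![((1 - (q : ℂ) ^ 2)⁻¹ ^ 2 * (q : ℂ) ^ 2) • (yInv q α * (x₀ * ((zX q α * x₁ - x₁ * zX q α) *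
        (star (zX q α) * x₂ - x₂ * star (zX q α))))), 0;
      0, (-((1 - (q : ℂ) ^ 2)⁻¹ ^ 2)) • (yInv q α * (x₀ *
        ((star (zX q α) * x₁ - x₁ * star (zX q α)) * (zX q α * x₂ - x₂ * zX q α))))] :=
  grading_mul_commutator_mul_commutator _ _ _ _ _ _ _

theorem commOp_entry_mem {x₀ x₁ x₂ : XAlg α} (h₀ : x₀ ∈ Xc q α) (h₁ : x₁ ∈ Xc q α)
    (h₂ : x₂ ∈ Xc q α) (i j : Fin 2) : commOp q α x₀ x₁ x₂ i j ∈ Xc q α := by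
  obtain ⟨hz, hw⟩ := isMulStable_z_and_star hq hq1 α
  have hy := isMulStable_yInv hq hq1 α
  rw [commOp_eq]
  fin_cases i <;> fin_cases j
  · exact SMulMemClass.smul_mem _ (hy.left _ (mul_mem h₀ (mul_mem
      (sub_mem (hz.left _ h₁) (hz.right _ h₁)) (sub_mem (hw.left _ h₂) (hw.right _ h₂)))))
  · exact zero_mem _
  · exact zero_mem _
  · exact SMulMemClass.smul_mem _ (hy.left _ (mul_mem h₀ (mul_mem
      (sub_mem (hw.left _ h₁) (hw.right _ h₁)) (sub_mem (hz.left _ h₂) (hz.right _ h₂)))))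

theorem hasTraceClassClosure_commOp {x₀ x₁ x₂ : XAlg α} (h₀ : x₀ ∈ Xc q α) (h₁ : x₁ ∈ Xc q α)
    (h₂ : x₂ ∈ Xc q α) : HasTraceClassClosure (matrixOp (commOp q α x₀ x₁ x₂)) :=
  hasTraceClassClosure_matrixOp (nonempty_idx_equiv α).some (summable_yEigenvalue hq hq1 α)
    fun i j => isDominated_of_mem hq hq1 α (commOp_entry_mem hq hq1 α h₀ h₁ h₂ i j)

theorem trace_commOp {T : XAlg α →ₗ[ℂ] ℂ}
    (hT : ∀ x ∈ Xc q α, T x = opTrace (domBasis (eBasis α)) x.1) {x₀ x₁ x₂ : XAlg α}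
    (h₀ : x₀ ∈ Xc q α) (h₁ : x₁ ∈ Xc q α) (h₂ : x₂ ∈ Xc q α) :
    T (yInv q α * (x₀ * wedgeCoeff ((q : ℂ) ^ 2) (zX q α) (star (zX q α)) x₁ x₂)) =
      -opTrace (dom₂Basis (eBasis α)) (matrixOp (commOp q α x₀ x₁ x₂)) := by
  have hm := commOp_entry_mem hq hq1 α h₀ h₁ h₂
  rw [opTrace_matrixOp (summable_yEigenvalue hq hq1 α)
    fun i j => isDominated_of_mem hq hq1 α (hm i j), ← hT _ (hm 0 0), ← hT _ (hm 1 1),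
    ← map_add, ← map_neg, commOp_eq]
  exact congrArg T ((neg_eq_iff_eq_neg.2 (trace_part_commutator _ _ _ _ _ _ _)).symm)

end Quantum


end

set_option maxHeartbeats 1000000 in
theorem theorem2p1 (q : ℝ) (hq0 : 0 < q) (hq1 : q < 1) (α : SignType) :
    -- the operators `z`, `z∗` give a representation of the `∗`-algebra `X₀`
    (∃ φ : X₀ q α →ₐ[ℂ] XAlg α, φ (X₀.gen q α 0) = zX q α ∧ φ (X₀.gen q α 1) = star (zX q α)) ∧
    -- `y` is invertible in `X`, and `y⁻¹x` has a trace class closure for `x ∈ X_c`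
    IsUnit (yX q α) ∧
    (∀ x ∈ Xc q α, HasTraceClassClosure (yInv q α * x).1) ∧
    -- the commutator calculus is the distinguished one, with left module basis `dz, dz∗`
    (let ρ := rhoX α
     let z := zX q α
     let dz := dif ρ (FX q α) z
     let dzs := dif ρ (FX q α) (star z)
     dz * ρ z = (q : ℂ) ^ 2 • (ρ z * dz) ∧
     dz * ρ (star z) = ((q : ℂ) ^ 2)⁻¹ • (ρ (star z) * dz) ∧
     dzs * ρ z = (q : ℂ) ^ 2 • (ρ z * dzs) ∧
     dzs * ρ (star z) = ((q : ℂ) ^ 2)⁻¹ • (ρ (star z) * dzs) ∧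
     ∀ g ∈ OneForm ρ (FX q α), ∃! p : XAlg α × XAlg α, g = ρ p.1 * dz + ρ p.2 * dzs) ∧
    -- `ω` is a two-form, a left module basis of the two-forms, and commutes with `X`
    omegaX q α ∈ TwoForm (rhoX α) (FX q α) ∧
    (∀ η ∈ TwoForm (rhoX α) (FX q α), ∃! a : XAlg α,
      η = Forms.fn (rhoX α) (FX q α) a * omegaX q α) ∧
    (∀ x : XAlg α, omegaX q α * Forms.fn (rhoX α) (FX q α) x =
      Forms.fn (rhoX α) (FX q α) x * omegaX q α) ∧
    -- `h` is a `σ`-twisted trace on `X_c` and vanishes on the forms `dx₁ ∧ dx₂`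
    (∀ x₁ ∈ Xc q α, ∀ x₂ ∈ Xc q α, hX q α (x₁ * x₂) = hX q α (sigmaX q α x₂ * x₁)) ∧
    (∀ x₁ ∈ Xc q α, ∀ x₂ ∈ Xc q α,
      formCoeff (rhoX α) (FX q α) (omegaX q α)
        (Forms.d (rhoX α) (FX q α) x₁ * Forms.d (rhoX α) (FX q α) x₂) ∈ Xc q α ∧
      hX q α (formCoeff (rhoX α) (FX q α) (omegaX q α)
        (Forms.d (rhoX α) (FX q α) x₁ * Forms.d (rhoX α) (FX q α) x₂)) = 0) ∧
    -- `τ_{ω,h}` is a `σ`-twisted cyclic 2-cocycle on `X_c`, given by the commutator formula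
    ∃ σ : Xc q α →ₙₐ[ℂ] Xc q α, (∀ x, (σ x : XAlg α) = sigmaX q α x) ∧
    ∃ τ : MultilinearMap ℂ (fun _ : Fin (2 + 1) => Xc q α) ℂ,
      (∀ x₀ x₁ x₂ : Xc q α,
        formCoeff (rhoX α) (FX q α) (omegaX q α) (Forms.fn (rhoX α) (FX q α) x₀ *
          Forms.d (rhoX α) (FX q α) x₁ * Forms.d (rhoX α) (FX q α) x₂) ∈ Xc q α ∧
        τ ![x₀, x₁, x₂] = tauForm (rhoX α) (FX q α) (omegaX q α) (hX q α) x₀ x₁ x₂) ∧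
      IsTwistedCyclicCocycle σ τ ∧
      ∀ x₀ x₁ x₂ : Xc q α,
        HasTraceClassClosure (matrixOp (commOp q α x₀ x₁ x₂)) ∧
        τ ![x₀, x₁, x₂] = -opTrace (dom₂Basis (eBasis α)) (matrixOp (commOp q α x₀ x₁ x₂)) := by
  have H := isQuantumPlane hq0 hq1 α
  refine Exists.elim (exists_isCoreTrace hq0 hq1 α) fun T hTh => ?_
  have hT := hTh.1
  have h := hTh.2
  -- `T` agrees with the trace only on `X_c`, which contains `y⁻¹x` by stability.
  have hX : ∀ x ∈ Xc q α, hX q α x = T (yInv q α * x) := fun x hx =>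
    (hT _ (h.yi.left x hx)).symm
  -- By definition `omegaX` is `volume` at `p = q²`, so the abstract coefficient formulas apply
  -- without rewriting.
  have hπ : ∀ x₁ x₂ : XAlg α, formCoeff (rhoX α) (FX q α) (omegaX q α)
      (Forms.d (rhoX α) (FX q α) x₁ * Forms.d (rhoX α) (FX q α) x₂) =
        wedgeCoeff ((q : ℂ) ^ 2) (zX q α) (star (zX q α)) x₁ x₂ := H.formCoeff_d_mul_d
  have hπ₀ : ∀ x₀ x₁ x₂ : XAlg α, formCoeff (rhoX α) (FX q α) (omegaX q α)
      (Forms.fn (rhoX α) (FX q α) x₀ * Forms.d (rhoX α) (FX q α) x₁ *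
        Forms.d (rhoX α) (FX q α) x₂) =
        x₀ * wedgeCoeff ((q : ℂ) ^ 2) (zX q α) (star (zX q α)) x₁ x₂ :=
    H.formCoeff_fn_mul_d_mul_d
  have hmem : ∀ x₁ ∈ Xc q α, ∀ x₂ ∈ Xc q α,
      wedgeCoeff ((q : ℂ) ^ 2) (zX q α) (star (zX q α)) x₁ x₂ ∈ Xc q α :=
    fun x₁ h₁ x₂ h₂ => wedgeCoeff_mem h.z h.w _ h₁ h₂
  refine ⟨exists_hom_of_relation (z_rel hq0 hq1 α),
    (exists_yUnit hq0 hq1 α).imp fun _ h => h.1, fun x hx => ?_,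
    ⟨H.dif_z_mul_z, H.dif_z_mul_w, H.dif_w_mul_z, H.dif_w_mul_w,
      fun g hg => H.existsUnique_combination hg⟩,
    H.volume_mem, fun η hη => H.existsUnique_coeff hη, H.volume_comm,
    fun x₁ h₁ x₂ h₂ => ?_, fun x₁ h₁ x₂ h₂ => ?_,
    h.conjHom H, fun _ => rfl,
    wedgeCocycle (Xc q α) T ((q : ℂ) ^ 2) (zX q α) (star (zX q α)) (yInv q α),
    fun x₀ x₁ x₂ => ?_, h.isTwistedCyclicCocycle H, fun x₀ x₁ x₂ => ?_⟩
  · exact (isDominated_of_mem hq0 hq1 α (h.yi.left x hx)).hasTraceClassClosure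
      (nonempty_idx_equiv α).some (summable_yEigenvalue hq0 hq1 α)
  · have h3 : sigmaX q α x₂ * x₁ ∈ Xc q α := mul_mem (h.yi.right _ (h.y.left _ h₂)) h₁
    rw [hX _ (mul_mem h₁ h₂), hX _ h3]
    exact h.twisted H h₁ h₂
  · rw [hπ]
    exact ⟨hmem x₁ h₁ x₂ h₂, (hX _ (hmem x₁ h₁ x₂ h₂)).trans (h.wedgeCoeff_eq_zero H h₁ h₂)⟩
  · have h3 := mul_mem x₀.2 (hmem x₁ x₁.2 x₂ x₂.2)
    rw [tauForm, hπ₀]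
    exact ⟨h3, (hX _ h3).symm⟩
  · exact ⟨hasTraceClassClosure_commOp hq0 hq1 α x₀.2 x₁.2 x₂.2,
      trace_commOp hq0 hq1 α hT x₀.2 x₁.2 x₂.2⟩
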